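/- **Theorem 1.** All circuits are over the elementary gates $H$, $X$, $T$, $\mathrm{CNOT}$. A random quantum circuit with a main register of $w$ qubits and $m$ steps is given by elementary gates $w_j,\eta_j$ ($j=1,\dots,m$) on the main register. It acts on $n=w+m$ qubits (main register and $m$ ancilla qubits), starts in $|0^n\rangle$, at each step $j$ independently applies with probability $1/2$ each either $w_j\otimes I$ or $\eta_j\otimes X$, where $X$ acts on the $j$-th ancilla qubit, and finally all $n$ qubits are measured in the computational basis. Let $p_z$ be the probability that the outcome is $z\in\{0,1\}^n$, and for a fidelity $F$ let $p'_z=Fp_z+\frac{1-F}{2^n}$ be the output distribution of the globally depolarized circuit. Let $0<F<1$ and $\epsilon<1$ be constants. Suppose that there is a classical probabilistic algorithm which, given the description of any such random circuit, runs in time polynomial in $n$ and outputs each $z\in\{0,1\}^n$ with a probability $q_z$ such that $|p'_z-q_z|\le\epsilon\,p'_z$. Then $\mathrm{BQP}\subseteq\mathrm{SBP}$. Here $L\in\mathrm{BQP}$ means that there is a polynomial-time uniformly generated family of quantum circuits $\{V_x\}_x$ such that measuring the first qubit of $V_x|0\cdots0\rangle$ gives $1$ with probability at least $2/3$ if $x\in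 L$ and at most $1/3$ if $x\notin L$; and $L\in\mathrm{SBP}$ means that there are a polynomial $s$ and a classical polynomial-time probabilistic algorithm whose acceptance probability on $x$ is at least $2^{-s(|x|)}$ if $x\in L$ and at most $2^{-s(|x|)-1}$ if $x\notin L$. -/

import Mathlib

namespace QSampling

/-! ### Classical probabilistic machines with a step count

Machines have finitely many stacks of bits (those named in the program), a finite structured
control, and a fair coin. One step inspects or changes only the top of one stack, so running times
agree with those of multi-tape Turing machines up to a polynomial. -/

/-- Programs of a probabilistic multi-stack machine. -/
inductive Prog : Type
  /-- put the bit `b` on top of stack `k` -/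
  | push (k : ℕ) (b : Bool) : Prog
  /-- remove the top bit of stack `k` (no effect on an empty stack) -/
  | pop (k : ℕ) : Prog
  /-- toss a fair coin and put the result on top of stack `k` -/
  | flip (k : ℕ) : Prog
  /-- do `p`, then `q` -/
  | seq (p q : Prog) : Prog
  /-- do `pe` if stack `k` is empty, `p0` if its top bit is 0, and `p1` if its top bit is 1 -/
  | branch (k : ℕ) (pe p0 p1 : Prog) : Prog
  /-- repeat `p` as long as stack `k` is not empty at the start of the round -/
  | loop (k : ℕ) (p : Prog) : Prog

/-- The contents of the stacks; the head of a list is the top of the stack. -/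
abbrev Store : Type := ℕ → List Bool

/-- A configuration: the programs that remain to be executed, and the stacks. The control part
takes only finitely many values in the runs of a given program. -/
abbrev Cfg : Type := List Prog × Store

/-- One computation step. Every step comes with a fresh coin, which only `flip` uses.
A configuration without remaining programs has halted. -/
def step : Cfg → Bool → Cfg
  | ([], s), _ => ([], s)
  | (Prog.push k b :: c, s), _ => (c, Function.update s k (b :: s k))
  | (Prog.pop k :: c, s), _ => (c, Function.update s k (s k).tail)
  | (Prog.flip k :: c, s), coin => (c, Function.update s k (coin :: s k))
  | (Prog.seq p q :: c, s), _ => (p :: q :: c, s)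
  | (Prog.branch k pe p0 p1 :: c, s), _ =>
      match s k with
      | [] => (pe :: c, s)
      | false :: _ => (p0 :: c, s)
      | true :: _ => (p1 :: c, s)
  | (Prog.loop k p :: c, s), _ =>
      match s k with
      | [] => (c, s)
      | _ :: _ => (p :: Prog.loop k p :: c, s)

/-- The initial configuration: the input is on stack 0, all other stacks are empty. -/
def init (p : Prog) (x : List Bool) : Cfg :=
  ([p], Function.update (fun _ => []) 0 x)

/-- The output of a configuration: the contents of stack 0 if the machine has halted,
and `none` if it is still running. -/
def output : Cfg → Option (List Bool)
  | ([], s) => some (s 0)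
  | (_ :: _, _) => none

/-- The result of running `p` on input `x` for `t` steps with the coin sequence `r`. -/
def result (p : Prog) (x : List Bool) {t : ℕ} (r : Fin t → Bool) : Option (List Bool) :=
  output ((List.ofFn r).foldl step (init p x))

/-- On input `x`, whatever the coins are, the machine halts after at most `t` steps. -/
def HaltsWithin (p : Prog) (x : List Bool) (t : ℕ) : Prop :=
  ∀ r : Fin t → Bool, (result p x r).isSome = true

/-- The probability, over `t` independent fair coins, that `p` on input `x` has halted after
`t` steps with output `y`. -/
noncomputable def outputProb (p : Prog) (x : List Bool) (t : ℕ) (y : List Bool) : ℝ :=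
  ((Finset.univ.filter fun r : Fin t → Bool => result p x r = some y).card : ℝ) / 2 ^ t

/-- The probability, over `t` independent fair coins, that `p` on input `x` has halted after
`t` steps and accepts, that is, its output starts with the bit 1. -/
noncomputable def machineAcceptProb (p : Prog) (x : List Bool) (t : ℕ) : ℝ :=
  ((Finset.univ.filter fun r : Fin t → Bool =>
    (result p x r).bind List.head? = some true).card : ℝ) / 2 ^ t

/-- The program never tosses a coin. -/
def Prog.CoinFree : Prog → Prop
  | .push _ _ => True
  | .pop _ => True
  | .flip _ => False
  | .seq p q => p.CoinFree ∧ q.CoinFree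
  | .branch _ pe p0 p1 => pe.CoinFree ∧ p0.CoinFree ∧ p1.CoinFree
  | .loop _ p => p.CoinFree

/-- `f` is computed by a deterministic polynomial-time machine. -/
def PolyTimeComputable (f : List Bool → List Bool) : Prop :=
  ∃ (p : Prog) (T : Polynomial ℕ), p.CoinFree ∧
    ∀ (x : List Bool) (r : Fin (T.eval x.length) → Bool), result p x r = some (f x)

/-! ### Quantum circuits -/

/-- Elementary gates on `n` qubits. -/
inductive Gate (n : ℕ) : Type
  | H (i : Fin n) : Gate n
  | X (i : Fin n) : Gate n
  | T (i : Fin n) : Gate n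
  /-- controlled NOT with control `c` and target `t` -/
  | CNOT (c t : Fin n) (hct : c ≠ t) : Gate n

/-- State vectors of `n` qubits: amplitudes in the computational basis. -/
abbrev QState (n : ℕ) : Type := (Fin n → Bool) → ℂ

/-- The state `|0^n⟩`. -/
def zeroState (n : ℕ) : QState n := fun z => if z = fun _ => false then 1 else 0

/-- The Hadamard matrix. -/
noncomputable def hMat : Matrix Bool Bool ℂ := fun a b =>
  (if (a && b) then -1 else 1) / (Real.sqrt 2 : ℂ)

/-- The Pauli X matrix. -/
def xMat : Matrix Bool Bool ℂ := fun a b => if a = b then 0 else 1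

/-- The T matrix `diag(1, exp(iπ/4))`. -/
noncomputable def tMat : Matrix Bool Bool ℂ :=
  Matrix.diagonal fun a => if a then Complex.exp (Complex.I * (Real.pi / 4)) else 1

/-- The one-qubit operator `U` acting on qubit `i`. -/
def applyOne {n : ℕ} (U : Matrix Bool Bool ℂ) (i : Fin n) (ψ : QState n) : QState n :=
  fun z => ∑ b : Bool, U (z i) b * ψ (Function.update z i b)

/-- The action of an elementary gate on a state vector. -/
noncomputable def Gate.apply {n : ℕ} : Gate n → QState n → QState n
  | .H i, ψ => applyOne hMat i ψ
  | .X i, ψ => applyOne xMat i ψ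
  | .T i, ψ => applyOne tMat i ψ
  | .CNOT c t _, ψ => fun z => ψ (Function.update z t (xor (z c) (z t)))

/-- Quantum circuits on `n` qubits; the head of the list is applied first. -/
abbrev Circuit (n : ℕ) : Type := List (Gate n)

/-- The state that the circuit produces from `|0^n⟩`. -/
noncomputable def finalState {n : ℕ} (V : Circuit n) : QState n :=
  V.foldl (fun ψ g => g.apply ψ) (zeroState n)

/-- The probability that measuring all qubits of the final state gives `z`. -/
noncomputable def measureProb {n : ℕ} (V : Circuit n) (z : Fin n → Bool) : ℝ :=
  ‖finalState V z‖ ^ 2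

/-- The acceptance probability of a circuit: the probability that qubit 0 is measured as 1. -/
noncomputable def circuitAcceptProb {n : ℕ} (V : Circuit (n + 1)) : ℝ :=
  ∑ z ∈ Finset.univ.filter (fun z : Fin (n + 1) → Bool => z 0 = true), measureProb V z

/-! ### Random quantum circuits -/

/-- A gate on the first `w` qubits, as a gate on `w + m` qubits. -/
def Gate.extend {w : ℕ} (m : ℕ) : Gate w → Gate (w + m)
  | .H i => .H (Fin.castAdd m i)
  | .X i => .X (Fin.castAdd m i)
  | .T i => .T (Fin.castAdd m i)
  | .CNOT c t hct => .CNOT (Fin.castAdd m c) (Fin.castAdd m t)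
      (fun e => hct (Fin.castAdd_injective w m e))

/-- A random circuit on `w + m` qubits, with a main register of `w` qubits and an ancilla register
of `m` qubits, given by two elementary gates `(C j).1` and `(C j).2` on the main register for each
of its `m` steps. Step `j` applies, with probability 1/2 each, either `(C j).1` on the main
register and nothing on the ancillas, or `(C j).2` on the main register and `X` on the `j`-th
ancilla qubit. -/
abbrev RandomCircuit (w m : ℕ) : Type := Fin m → Gate w × Gate w

/-- The circuit on `w + m` qubits that is applied if the random choices are `α`. -/
def RandomCircuit.realize {w m : ℕ} (C : RandomCircuit w m) (α : Fin m → Bool) :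
    Circuit (w + m) :=
  (List.ofFn fun j : Fin m =>
    if α j then [(C j).2.extend m, Gate.X (Fin.natAdd w j)] else [(C j).1.extend m]).flatten

/-- `p_z`: the probability that the ideal random circuit outputs `z`. -/
noncomputable def RandomCircuit.idealProb {w m : ℕ} (C : RandomCircuit w m)
    (z : Fin (w + m) → Bool) : ℝ :=
  (∑ α : Fin m → Bool, measureProb (C.realize α) z) / 2 ^ m

/-- `p'_z = F p_z + (1 - F) / 2^n`, where `n = w + m`: the output probabilities of the globally
depolarized random circuit with fidelity `F`. -/
noncomputable def RandomCircuit.depolarizedProb {w m : ℕ} (F : ℝ) (C : RandomCircuit w m)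
    (z : Fin (w + m) → Bool) : ℝ :=
  F * C.idealProb z + (1 - F) / 2 ^ (w + m)

/-! ### Descriptions of circuits as bit strings -/

/-- Self-delimiting unary notation. -/
def unary (k : ℕ) : List Bool := List.replicate k true ++ [false]

/-- Two bits for the kind of the gate, then the qubits it acts on. -/
def Gate.encode {n : ℕ} : Gate n → List Bool
  | .H i => false :: false :: unary i
  | .X i => false :: true :: unary i
  | .T i => true :: false :: unary i
  | .CNOT c t _ => true :: true :: (unary c ++ unary t)

/-- The description of a circuit: the number of qubits, then the gates. -/
def encodeCircuit {n : ℕ} (V : Circuit n) : List Bool :=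
  unary n ++ V.flatMap Gate.encode

/-- The description of a random circuit: the size of the main register, then the pairs of gates. -/
def RandomCircuit.encode {w m : ℕ} (C : RandomCircuit w m) : List Bool :=
  unary w ++ (List.ofFn C).flatMap fun g => g.1.encode ++ g.2.encode

/-! ### Complexity classes and samplers -/

/-- Languages over the binary alphabet. -/
abbrev Lang : Type := Set (List Bool)

/-- BQP: languages decided with error at most 1/3 by a polynomial-time uniformly generated family
of quantum circuits `V x`. -/
def BQP : Set Lang :=
  {L | ∃ (w : List Bool → ℕ) (V : ∀ x : List Bool, Circuit (w x + 1)),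
    PolyTimeComputable (fun x => encodeCircuit (V x)) ∧
    ∀ x : List Bool,
      (x ∈ L → 2 / 3 ≤ circuitAcceptProb (V x)) ∧ (x ∉ L → circuitAcceptProb (V x) ≤ 1 / 3)}

/-- SBP: some probabilistic polynomial-time machine accepts `x` with probability at least
`2 ^ (-s(|x|))` if `x ∈ L`, and at most `2 ^ (-s(|x|) - 1)` if `x ∉ L`, for a polynomial `s`. -/
def SBP : Set Lang :=
  {L | ∃ (s T : Polynomial ℕ) (p : Prog), ∀ x : List Bool,
    HaltsWithin p x (T.eval x.length) ∧
    (x ∈ L → 1 / 2 ^ (s.eval x.length) ≤ machineAcceptProb p x (T.eval x.length)) ∧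
    (x ∉ L → machineAcceptProb p x (T.eval x.length) ≤ 1 / 2 ^ (s.eval x.length + 1))}

/-- A classical probabilistic machine that, given the description of a random circuit on `n`
qubits, runs in time polynomial in `n` and samples the output distribution of the globally
depolarized random circuit with fidelity `F` within multiplicative error `ε`. -/
def DepolarizedSampling (F ε : ℝ) : Prop :=
  ∃ (S : Prog) (T : Polynomial ℕ), ∀ (w m : ℕ) (C : RandomCircuit w m),
    HaltsWithin S C.encode (T.eval (w + m)) ∧
    ∀ z : Fin (w + m) → Bool,
      |C.depolarizedProb F z - outputProb S C.encode (T.eval (w + m)) (List.ofFn z)|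
        ≤ ε * C.depolarizedProb F z

end QSampling

namespace QSampling

/-! ### Runs of programs -/

/-! Let `V` accept with probability `A`, and run a constant number `k` of copies of it side by side.
The event that all `k` first qubits are 1 has probability `A ^ k` in the ideal circuit and `2 ^
(-k)` under uniform noise. A plain circuit becomes a random circuit by using each gate for both
random choices: the main register is then unaffected, and the ancillas hold the random choices,
hence are uniform and independent of it (`finalState_realize_duplicate`, `idealProb_duplicate`). So
the depolarized probability of the event is `F * A ^ k + (1 - F) / 2 ^ k` (`sum_depolarizedProb`),
and the multiplicative error of the sampler, summed over the event, changes it by a factor between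
`1 - ε` and `1 + ε`.

If `x ∈ L`, the result is at least `(1 - ε) * F * (2/3) ^ k`. If `x ∉ L`, then `A ≤ 1/3 ≤ 1/2`, and
the result is at most `(1 + ε) / 2 ^ k ≤ 2 / 2 ^ k`. Since `(4/3) ^ k` is unbounded, a constant `k`
makes the first bound at least `4 / 2 ^ k`. This is the factor 2 that SBP asks for, with a constant
polynomial `s`.

The rest is the machine that accepts when the sampled string lies in the event. It computes the
description of `V x`, turns it into that of the duplicated parallel circuit (`exec_transform`,
`exec_prepare`), runs the sampler and checks its output (`exec_sampleCheck`). The three phases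
coexist because stacks are separated modulo 3: the uniform generator uses stacks `3 i`, the sampler
stacks `3 i + 1`, and the work stacks and the qubit count are 2 modulo 3. `machineAcceptProb_sample`
and `acceptProb_eq_sum` identify the acceptance probability with the sampler's mass on the event. -/

theorem foldl_step_nil (r : List Bool) (s : Store) : r.foldl step ([], s) = ([], s) := by
  induction r with
  | nil => rfl
  | cons b r ih => simpa [step] using ih

theorem step_append (p : Prog) (l c : List Prog) (s : Store) (b : Bool) :
    step (p :: l ++ c, s) b = ((step (p :: l, s) b).1 ++ c, (step (p :: l, s) b).2) := by
  cases p <;> simp only [step, List.cons_append]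
  all_goals split <;> rfl

/-- A halted run, with more programs waiting, reaches the waiting programs at some time. -/
theorem exists_prefix_of_halted (r : List Bool) (l : List Prog) (s : Store)
    (h : (r.foldl step (l, s)).1 = []) :
    ∃ r₀ r₁, r = r₀ ++ r₁ ∧
      ∀ c, r₀.foldl step (l ++ c, s) = (c, (r.foldl step (l, s)).2) := by
  induction r generalizing l s with
  | nil =>
    obtain rfl : l = [] := h
    exact ⟨[], [], rfl, fun c => rfl⟩
  | cons b r ih =>
    cases l with
    | nil => exact ⟨[], b :: r, rfl, fun c => by rw [foldl_step_nil]; rfl⟩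
    | cons p l =>
      obtain ⟨r₀, r₁, hr, hc⟩ := ih (step (p :: l, s) b).1 (step (p :: l, s) b).2 h
      refine ⟨b :: r₀, r₁, by rw [hr]; rfl, fun c => ?_⟩
      rw [List.foldl_cons, step_append, hc]
      rfl

/-- Rename the stacks of a program. -/
def Prog.rename (f : ℕ → ℕ) : Prog → Prog
  | .push k b => .push (f k) b
  | .pop k => .pop (f k)
  | .flip k => .flip (f k)
  | .seq p q => .seq (p.rename f) (q.rename f)
  | .branch k pe p0 p1 => .branch (f k) (pe.rename f) (p0.rename f) (p1.rename f)
  | .loop k p => .loop (f k) (p.rename f)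

/-- One step of a simulation: the original program sees the store through `f`. Injectivity keeps a
write to one renamed stack from showing up on another. -/
theorem step_rename {f : ℕ → ℕ} (hf : f.Injective) (l : List Prog) (s : Store) (b : Bool) :
    (step (l.map (Prog.rename f), s) b).1 = (step (l, s ∘ f) b).1.map (Prog.rename f) ∧
    (step (l.map (Prog.rename f), s) b).2 ∘ f = (step (l, s ∘ f) b).2 ∧
    ∀ i, (∀ j, f j ≠ i) → (step (l.map (Prog.rename f), s) b).2 i = s i := by
  have hu : ∀ (k : ℕ) (v : List Bool),
      Function.update s (f k) v ∘ f = Function.update (s ∘ f) k v := fun k v =>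
    Function.update_comp_eq_of_injective s hf k v
  have hn : ∀ (k : ℕ) (v : List Bool) (i : ℕ), (∀ j, f j ≠ i) →
      Function.update s (f k) v i = s i := fun k v i hi =>
    Function.update_of_ne (hi k).symm _ _
  rcases l with _ | ⟨p, l⟩
  · simp [step]
  cases p with
  | push k b => simpa [step, Prog.rename, hu] using hn k _
  | pop k => simpa [step, Prog.rename, hu] using hn k _
  | flip k => simpa [step, Prog.rename, hu] using hn k _
  | seq p q => simp [step, Prog.rename]
  | branch k pe p0 p1 =>
    simp only [step, Prog.rename, List.map_cons, Function.comp_apply]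
    rcases s (f k) with _ | ⟨_ | _, _⟩ <;> simp
  | loop k p =>
    simp only [step, Prog.rename, List.map_cons, Function.comp_apply]
    rcases s (f k) with _ | ⟨_, _⟩ <;> simp [Prog.rename]

theorem foldl_step_rename {f : ℕ → ℕ} (hf : f.Injective) (r : List Bool) (l : List Prog)
    (s : Store) :
    (r.foldl step (l.map (Prog.rename f), s)).1 =
      (r.foldl step (l, s ∘ f)).1.map (Prog.rename f) ∧
    (r.foldl step (l.map (Prog.rename f), s)).2 ∘ f = (r.foldl step (l, s ∘ f)).2 ∧
    ∀ i, (∀ j, f j ≠ i) → (r.foldl step (l.map (Prog.rename f), s)).2 i = s i := by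
  induction r generalizing l s with
  | nil => simp
  | cons b r ih =>
    obtain ⟨h1, h2, h3⟩ := step_rename hf l s b
    obtain ⟨i1, i2, i3⟩ := ih (step (l, s ∘ f) b).1 (step (l.map (Prog.rename f), s) b).2
    rw [h2] at i1 i2
    simp only [List.foldl_cons]
    have e : step (l.map (Prog.rename f), s) b =
        ((step (l, s ∘ f) b).1.map (Prog.rename f), (step (l.map (Prog.rename f), s) b).2) := by
      rw [← h1]
    rw [e]
    exact ⟨i1, i2, fun i hi => by rw [i3 i hi, h3 i hi]⟩

theorem step_coinFree (l : List Prog) (s : Store) (hl : ∀ p ∈ l, p.CoinFree) (b b' : Bool) :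
    step (l, s) b = step (l, s) b' ∧ ∀ p ∈ (step (l, s) b).1, p.CoinFree := by
  rcases l with _ | ⟨p, l⟩
  · simp [step]
  rw [List.forall_mem_cons] at hl
  obtain ⟨hp, hl⟩ := hl
  cases p with
  | flip k => exact hp.elim
  | push k b => simpa [step] using hl
  | pop k => simpa [step] using hl
  | seq p q =>
    obtain ⟨h1, h2⟩ := hp
    simpa [step] using ⟨h1, h2, hl⟩
  | branch k pe p0 p1 =>
    obtain ⟨h1, h2, h3⟩ := hp
    simp only [step]
    rcases s k with _ | ⟨_ | _, _⟩ <;> simpa using ⟨by assumption, hl⟩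
  | loop k p =>
    simp only [step]
    rcases s k with _ | ⟨_, _⟩
    · simpa using hl
    · have h : p.CoinFree := hp
      simpa using ⟨h, hp, hl⟩

/-- One observed run of a coin-free program determines the run for every coin sequence of the same
length, which is what `Exec` demands. -/
theorem foldl_step_append_coinFree (r : List Bool) (l : List Prog) (s s' : Store)
    (hl : ∀ p ∈ l, p.CoinFree) (h : ∀ c, r.foldl step (l ++ c, s) = (c, s')) (r' : List Bool)
    (hr : r'.length = r.length) (c : List Prog) : r'.foldl step (l ++ c, s) = (c, s') := by
  induction r generalizing l s r' with
  | nil =>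
    obtain rfl : r' = [] := List.length_eq_zero_iff.1 hr
    exact h c
  | cons b r ih =>
    rcases r' with _ | ⟨b', r'⟩
    · simp at hr
    cases l with
    | nil =>
      -- If `l` were used up with coins left over, the waiting program would start too early; the
      -- instance `[.pop 0]` exposes this.
      have := h [.pop 0]
      simp [step, foldl_step_nil] at this
    | cons p l =>
      obtain ⟨h1, h2⟩ := step_coinFree (p :: l) s hl b b'
      rw [List.foldl_cons, step_append, ← h1]
      refine ih _ _ h2 (fun c => ?_) r' (by simpa using hr)
      rw [← h c, List.foldl_cons, step_append]

theorem Prog.CoinFree.rename {p : Prog} (f : ℕ → ℕ) (hp : p.CoinFree) :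
    (p.rename f).CoinFree := by
  induction p with
  | flip k => exact hp
  | push k b => trivial
  | pop k => trivial
  | seq p q ihp ihq => exact ⟨ihp hp.1, ihq hp.2⟩
  | branch k pe p0 p1 h1 h2 h3 => exact ⟨h1 hp.1, h2 hp.2.1, h3 hp.2.2⟩
  | loop k p ih => exact ih hp

theorem length_step_le (c : Cfg) (b : Bool) (k : ℕ) :
    ((step c b).2 k).length ≤ (c.2 k).length + 1 := by
  obtain ⟨l, s⟩ := c
  have hu : ∀ (i : ℕ) (v : List Bool), v.length ≤ (s i).length + 1 →
      (Function.update s i v k).length ≤ (s k).length + 1 := by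
    intro i v hv
    by_cases h : k = i
    · subst h; simpa using hv
    · simp [Function.update_of_ne h]
  rcases l with _ | ⟨p, l⟩
  · simp [step]
  cases p with
  | push i b => exact hu _ _ (by simp)
  | pop i => exact hu _ _ (by simp; omega)
  | flip i => exact hu _ _ (by simp)
  | seq p q => simp [step]
  | branch i pe p0 p1 =>
    simp only [step]
    rcases s i with _ | ⟨_ | _, _⟩ <;> simp
  | loop i p =>
    simp only [step]
    rcases s i with _ | ⟨_, _⟩ <;> simp

theorem length_foldl_step_le (r : List Bool) (c : Cfg) (k : ℕ) :
    ((r.foldl step c).2 k).length ≤ (c.2 k).length + r.length := by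
  induction r generalizing c with
  | nil => simp
  | cons b r ih =>
    have h1 := ih (step c b)
    have h2 := length_step_le c b k
    simp only [List.foldl_cons, List.length_cons]
    omega

/-! ### Timed, coin-independent executions and their composition rules. -/

/-- Started on the store `s`, the program `p` terminates after at most `t` steps with the store
`s'`, whatever the coins are. -/
def Exec (p : Prog) (s : Store) (t : ℕ) (s' : Store) : Prop :=
  ∃ t' ≤ t, ∀ (c : List Prog) (r : List Bool), r.length = t' →
    r.foldl step (p :: c, s) = (c, s')

theorem Exec.mono {p s t s'} (h : Exec p s t s') {t₁} (ht : t ≤ t₁) : Exec p s t₁ s' := by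
  obtain ⟨t', h1, h2⟩ := h
  exact ⟨t', h1.trans ht, h2⟩

theorem Exec.of_step {p q : Prog} {s s₁ s' : Store} {t : ℕ} (l : List Prog)
    (h : ∀ c b, step (p :: c, s) b = (q :: l ++ c, s₁))
    (hq : ∃ t' ≤ t, ∀ (c : List Prog) (r : List Bool), r.length = t' →
      r.foldl step (q :: l ++ c, s₁) = (c, s')) : Exec p s (t + 1) s' := by
  obtain ⟨t', h1, h2⟩ := hq
  refine ⟨t' + 1, by omega, fun c r hr => ?_⟩
  rcases r with _ | ⟨b, r⟩
  · simp at hr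
  · rw [List.foldl_cons, h]
    exact h2 c r (by simpa using hr)

theorem Exec.pair {p q : Prog} {s s₁ s₂ : Store} {t₁ t₂ : ℕ} (hp : Exec p s t₁ s₁)
    (hq : Exec q s₁ t₂ s₂) : ∃ t' ≤ t₁ + t₂, ∀ (c : List Prog) (r : List Bool), r.length = t' →
      r.foldl step (p :: [q] ++ c, s) = (c, s₂) := by
  obtain ⟨a, ha, h1⟩ := hp
  obtain ⟨b, hb, h2⟩ := hq
  refine ⟨a + b, by omega, fun c r hr => ?_⟩
  rw [← List.take_append_drop a r, List.foldl_append]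
  have := h1 (q :: c) (r.take a) (by simp; omega)
  simp only [List.cons_append, List.nil_append]
  rw [this]
  exact h2 c _ (by simp; omega)

theorem Exec.push (k : ℕ) (b : Bool) (s : Store) :
    Exec (.push k b) s 1 (Function.update s k (b :: s k)) := by
  refine ⟨1, le_rfl, fun c r hr => ?_⟩
  obtain ⟨x, rfl⟩ := List.length_eq_one_iff.1 hr
  rfl

theorem Exec.pop (k : ℕ) (s : Store) :
    Exec (.pop k) s 1 (Function.update s k (s k).tail) := by
  refine ⟨1, le_rfl, fun c r hr => ?_⟩
  obtain ⟨x, rfl⟩ := List.length_eq_one_iff.1 hr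
  rfl

theorem Exec.seq {p q : Prog} {s s₁ s₂ : Store} {t₁ t₂ : ℕ} (hp : Exec p s t₁ s₁)
    (hq : Exec q s₁ t₂ s₂) : Exec (.seq p q) s (t₁ + t₂ + 1) s₂ :=
  Exec.of_step [q] (fun _ _ => rfl) (hp.pair hq)

theorem Exec.branch {k : ℕ} {pe p0 p1 : Prog} {s s' : Store} {t : ℕ}
    (he : s k = [] → Exec pe s t s')
    (h0 : ∀ l, s k = false :: l → Exec p0 s t s')
    (h1 : ∀ l, s k = true :: l → Exec p1 s t s') : Exec (.branch k pe p0 p1) s (t + 1) s' := by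
  rcases h : s k with _ | ⟨_ | _, l⟩
  · exact Exec.of_step [] (fun c b => by simp [step, h]) (he h)
  · exact Exec.of_step [] (fun c b => by simp [step, h]) (h0 l h)
  · exact Exec.of_step [] (fun c b => by simp [step, h]) (h1 l h)

theorem Exec.loop_nil {k : ℕ} {p : Prog} {s : Store} (h : s k = []) : Exec (.loop k p) s 1 s := by
  refine ⟨1, le_rfl, fun c r hr => ?_⟩
  obtain ⟨x, rfl⟩ := List.length_eq_one_iff.1 hr
  simp [step, h]

theorem Exec.loop_cons {k : ℕ} {p : Prog} {s s₁ s₂ : Store} {t₁ t₂ : ℕ} (h : s k ≠ [])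
    (hp : Exec p s t₁ s₁) (hl : Exec (.loop k p) s₁ t₂ s₂) :
    Exec (.loop k p) s (t₁ + t₂ + 1) s₂ := by
  refine Exec.of_step [.loop k p] (fun c b => ?_) (hp.pair hl)
  rcases hs : s k with _ | ⟨x, l⟩
  · exact absurd hs h
  · simp [step, hs]

/-- A renamed coin-free program runs like the original one, and leaves other stacks alone. -/
theorem Exec.rename {p : Prog} (hp : p.CoinFree) {f : ℕ → ℕ} (hf : f.Injective) (s : Store)
    (r : List Bool) (h : (r.foldl step ([p], s ∘ f)).1 = []) :
    ∃ s', Exec (p.rename f) s r.length s' ∧ s' ∘ f = (r.foldl step ([p], s ∘ f)).2 ∧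
      ∀ i, (∀ j, f j ≠ i) → s' i = s i := by
  obtain ⟨h1, h2, h3⟩ := foldl_step_rename hf r [p] s
  rw [h, List.map_nil] at h1
  obtain ⟨r₀, r₁, hr, hc⟩ := exists_prefix_of_halted r _ s h1
  refine ⟨_, ⟨r₀.length, by simp [hr], fun c r' hr' => ?_⟩, h2, h3⟩
  exact foldl_step_append_coinFree _ _ s _ (by simpa using hp.rename f) hc r' hr' c

theorem Exec.congr {p s t s'} (h : Exec p s t s') {t₁ s''} (hs : s' = s'') (ht : t ≤ t₁) :
    Exec p s t₁ s'' := hs ▸ h.mono ht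

/-! ### Building blocks of programs -/

/-- A program without effect. -/
def noop : Prog := .seq (.push 5 true) (.pop 5)

theorem exec_noop (s : Store) : Exec noop s 3 s := by
  exact ((Exec.push 5 true s).seq (Exec.pop 5 _)).congr (by simp) le_rfl

/-- Push `k` ones on stack `q`. -/
def pushOnes (q : ℕ) : ℕ → Prog
  | 0 => noop
  | k + 1 => .seq (.push q true) (pushOnes q k)

theorem exec_pushOnes (q k : ℕ) (s : Store) :
    Exec (pushOnes q k) s (2 * k + 3) (Function.update s q (List.replicate k true ++ s q)) := by
  induction k generalizing s with
  | zero => exact (exec_noop s).congr (by simp) le_rfl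
  | succ k ih =>
    exact ((Exec.push q true s).seq (ih _)).congr (by simp [List.replicate_succ']) (by omega)

/-- Read a number in unary notation from stack 0, and execute `p` for each of its units. -/
def readUnary (p : Prog) : Prog :=
  .seq (.push 5 true)
    (.loop 5 (.branch 0 (.pop 5) (.seq (.pop 0) (.pop 5)) (.seq (.pop 0) p)))

/-- Stack 5 holds a single marker that keeps the loop alive until the terminating 0 has been read.
The family `σ i a l` is the loop invariant: `i` units processed, `a` left on stack 0, `l` on stack
5. Keeping it abstract lets one proof serve both gate arguments and the header of a description. -/
theorem exec_readUnary {p : Prog} {t : ℕ} (σ : ℕ → List Bool → List Bool → Store)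
    (hA : ∀ i a l, σ i a l 0 = a) (hL : ∀ i a l, σ i a l 5 = l)
    (uA : ∀ i a l a', Function.update (σ i a l) 0 a' = σ i a' l)
    (uL : ∀ i a l l', Function.update (σ i a l) 5 l' = σ i a l')
    (hp : ∀ i a l, Exec p (σ i a l) t (σ (i + 1) a l)) (n : ℕ) (a : List Bool) :
    Exec (readUnary p) (σ 0 (unary n ++ a) []) ((n + 1) * (t + 6) + 2) (σ n a []) := by
  have key : ∀ i, Exec (.loop 5 (.branch 0 (.pop 5) (.seq (.pop 0) (.pop 5)) (.seq (.pop 0) p)))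
      (σ i (unary n ++ a) [true]) ((n + 1) * (t + 6)) (σ (i + n) a []) := by
    induction n with
    | zero =>
      intro i
      refine ((Exec.loop_cons (s₁ := σ i a []) (t₁ := 4) (by simp [hL]) ?_
        (Exec.loop_nil (hL _ _ _))).mono (t₁ := (0 + 1) * (t + 6)) (by omega))
      refine Exec.branch (fun h => ?_) (fun l h => ?_) (fun l h => ?_)
      · simp [hA, unary] at h
      · convert (Exec.pop 0 _).seq (Exec.pop 5 _) using 1
        simp [hA, hL, uA, uL, unary]
      · simp [hA, unary] at h
    | succ n ih =>
      intro i
      have h2 := ih (i + 1)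
      rw [show i + 1 + n = i + (n + 1) by omega] at h2
      refine ((Exec.loop_cons (t₁ := 1 + t + 1 + 1) (by simp [hL]) ?_ h2).mono ?_)
      · refine Exec.branch (fun h => ?_) (fun l h => ?_) (fun l h => ?_)
        · simp [hA, unary] at h
        · simp [hA, unary, List.replicate_succ] at h
        · refine (Exec.pop 0 _).seq ?_
          convert hp i _ _ using 1
          simp [hA, uA, unary, List.replicate_succ]
      · rw [Nat.add_mul (n + 1)]; omega
  have h := key 0
  rw [Nat.zero_add] at h
  have h' := Exec.push 5 true (σ 0 (unary n ++ a) [])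
  rw [uL, hL] at h'
  exact (h'.seq h).mono (by omega)

/-- Empty stack `q`. -/
def clear (q : ℕ) : Prog := .loop q (.pop q)

theorem exec_clear (q : ℕ) (s : Store) (n : ℕ) (h : (s q).length = n) :
    Exec (clear q) s (2 * n + 1) (Function.update s q []) := by
  induction n generalizing s with
  | zero =>
    have h0 : s q = [] := List.length_eq_zero_iff.1 h
    exact (Exec.loop_nil h0).congr (by rw [← h0, Function.update_eq_self]) (by omega)
  | succ n ih =>
    have h2 := ih (Function.update s q (s q).tail) (by simp [h])
    exact (Exec.loop_cons (by intro h'; simp [h'] at h) (Exec.pop q s) h2).congr (by simp)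
      (by omega)

/-- Move the ones on stack `q` to stack 14, and copy them to stack 2. -/
def moveCopy (q : ℕ) : Prog :=
  .loop q (.seq (.pop q) (.seq (.push 14 true) (.push 2 true)))

theorem exec_moveCopy {q : ℕ} (h2 : q ≠ 2) (h14 : q ≠ 14) (n : ℕ) (s : Store)
    (hs : s q = List.replicate n true) :
    Exec (moveCopy q) s (6 * n + 1) (Function.update (Function.update (Function.update s q [])
      14 (List.replicate n true ++ s 14)) 2 (List.replicate n true ++ s 2)) := by
  induction n generalizing s with
  | zero =>
    refine (Exec.loop_nil hs).congr ?_ (by omega)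
    ext1 i
    simp only [Function.update_apply]
    split_ifs <;> simp_all
  | succ n ih =>
    have hr := (Exec.pop q s).seq ((Exec.push 14 true _).seq (Exec.push 2 true _))
    refine (Exec.loop_cons (by simp [hs, List.replicate_succ]) hr (ih _ ?_)).congr ?_ (by omega)
    · simp [h2, h14, hs, List.replicate_succ]
    · have hr' : ∀ l, List.replicate n true ++ true :: l = true :: (List.replicate n true ++ l) := by
        intro l; rw [← List.cons_append, ← List.replicate_succ, List.replicate_succ']; simp
      ext1 i
      clear ih hr
      by_cases hi2 : i = 2
      · subst hi2; simp [h2.symm, hr', List.replicate_succ]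
      by_cases hi14 : i = 14
      · subst hi14; simp [h14.symm, hr', List.replicate_succ]
      by_cases hiq : i = q
      · subst hiq; simp [hi2, hi14]
      · simp [hi2, hi14, hiq]

/-- Move the ones on stack 14 to stack `q`. -/
def moveBack (q : ℕ) : Prog := .loop 14 (.seq (.pop 14) (.push q true))

theorem exec_moveBack {q : ℕ} (h14 : q ≠ 14) (n : ℕ) (s : Store)
    (hs : s 14 = List.replicate n true) :
    Exec (moveBack q) s (4 * n + 1) (Function.update (Function.update s 14 [])
      q (List.replicate n true ++ s q)) := by
  induction n generalizing s with
  | zero =>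
    refine (Exec.loop_nil hs).congr ?_ (by omega)
    ext1 i
    simp only [Function.update_apply]
    split_ifs <;> simp_all
  | succ n ih =>
    have hr := (Exec.pop 14 s).seq (Exec.push q true _)
    refine (Exec.loop_cons (by simp [hs, List.replicate_succ]) hr (ih _ ?_)).congr ?_ (by omega)
    · simp [h14.symm, hs, List.replicate_succ]
    · ext1 i
      simp only [Function.update_apply]
      split_ifs <;> simp_all [List.replicate_succ']

theorem reverse_unary (k : ℕ) : (unary k).reverse = false :: List.replicate k true := by
  simp [unary]

/-- With `n` ones on stack `q`, write the number `j + n` in unary notation on stack 2. -/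
def emitArg (q j : ℕ) : Prog :=
  .seq (pushOnes 2 j) (.seq (moveCopy q) (.seq (moveBack q) (.push 2 false)))

/-- Reading a stack destroys it, so the ones travel through stack 14 and back. Stack 2 collects the
output in reverse order, until `flush` restores the order. -/
theorem exec_emitArg {q : ℕ} (h2 : q ≠ 2) (h14 : q ≠ 14) (j n : ℕ) (s : Store)
    (hs : s q = List.replicate n true) (hs' : s 14 = []) :
    Exec (emitArg q j) s (2 * j + 10 * n + 9)
      (Function.update s 2 ((unary (j + n)).reverse ++ s 2)) := by
  have h := (exec_pushOnes 2 j s).seq ((exec_moveCopy h2 h14 n _ ?_).seq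
    ((exec_moveBack (q := q) h14 n _ ?_).seq (Exec.push 2 false _)))
  · refine h.congr ?_ (by omega)
    ext1 i
    simp only [Function.update_apply, Nat.add_comm j n, reverse_unary, hs', if_neg h2.symm,
      List.replicate_add]
    clear h
    split_ifs <;> simp_all
    rw [List.replicate_add, List.append_assoc]
  · simp [h2, hs]
  · simp [hs']

/-- Move the contents of stack 2 to stack 1 in reverse order. -/
def flush : Prog :=
  .loop 2 (.branch 2 noop (.seq (.pop 2) (.push 1 false)) (.seq (.pop 2) (.push 1 true)))

theorem exec_flush (l : List Bool) (s : Store) (hs : s 2 = l) :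
    Exec flush s (5 * l.length + 1)
      (Function.update (Function.update s 2 []) 1 (l.reverse ++ s 1)) := by
  induction l generalizing s with
  | nil =>
    refine (Exec.loop_nil hs).congr ?_ (by simp)
    ext1 i
    simp only [Function.update_apply]
    split_ifs <;> simp_all
  | cons b l ih =>
    have hr : Exec (.branch 2 noop (.seq (.pop 2) (.push 1 false))
        (.seq (.pop 2) (.push 1 true))) s 4
        (Function.update (Function.update s 2 l) 1 (b :: s 1)) := by
      refine Exec.branch (fun h => ?_) (fun l' h => ?_) (fun l' h => ?_)
      · simp [hs] at h
      · convert (Exec.pop 2 s).seq (Exec.push 1 false _) using 1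
        simp_all
      · convert (Exec.pop 2 s).seq (Exec.push 1 true _) using 1
        simp_all
    refine (Exec.loop_cons (by simp [hs]) hr (ih _ ?_)).congr ?_ (by simp; omega)
    · simp
    · ext1 i
      simp only [Function.update_apply]
      split_ifs <;> simp_all

/-! ### The program that produces the description of the parallel circuit -/

/-- A store with given contents of the stacks 0, 2, 5, 8, 11, 14, 17. -/
def regs (base : Store) (a o l b d e n : List Bool) : Store := fun i =>
  if i = 0 then a else if i = 2 then o else if i = 5 then l else if i = 8 then b else
  if i = 11 then d else if i = 14 then e else if i = 17 then n else base i

section regs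
variable (base : Store) (a o l b d e n v : List Bool)

@[simp] theorem regs_0 : regs base a o l b d e n 0 = a := rfl
@[simp] theorem regs_2 : regs base a o l b d e n 2 = o := rfl
@[simp] theorem regs_5 : regs base a o l b d e n 5 = l := rfl
@[simp] theorem regs_8 : regs base a o l b d e n 8 = b := rfl
@[simp] theorem regs_11 : regs base a o l b d e n 11 = d := rfl
@[simp] theorem regs_14 : regs base a o l b d e n 14 = e := rfl
@[simp] theorem regs_17 : regs base a o l b d e n 17 = n := rfl

@[simp] theorem update_regs_0 :
    Function.update (regs base a o l b d e n) 0 v = regs base v o l b d e n := by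
  ext1 i; simp only [Function.update_apply, regs]; split_ifs <;> simp_all
@[simp] theorem update_regs_2 :
    Function.update (regs base a o l b d e n) 2 v = regs base a v l b d e n := by
  ext1 i; simp only [Function.update_apply, regs]; split_ifs <;> simp_all
@[simp] theorem update_regs_5 :
    Function.update (regs base a o l b d e n) 5 v = regs base a o v b d e n := by
  ext1 i; simp only [Function.update_apply, regs]; split_ifs <;> simp_all
@[simp] theorem update_regs_8 :
    Function.update (regs base a o l b d e n) 8 v = regs base a o l v d e n := by
  ext1 i; simp only [Function.update_apply, regs]; split_ifs <;> simp_all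
@[simp] theorem update_regs_11 :
    Function.update (regs base a o l b d e n) 11 v = regs base a o l b v e n := by
  ext1 i; simp only [Function.update_apply, regs]; split_ifs <;> simp_all
@[simp] theorem update_regs_17 :
    Function.update (regs base a o l b d e n) 17 v = regs base a o l b d e v := by
  ext1 i; simp only [Function.update_apply, regs]; split_ifs <;> simp_all

end regs

/-- The description of a gate of kind `b₁, b₂` whose arguments are `j + p` and, if `two`,
`j + q`. -/
def gateCode (b₁ b₂ two : Bool) (p q j : ℕ) : List Bool :=
  b₁ :: b₂ :: (unary (j + p) ++ if two then unary (j + q) else [])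

def emitGate (b₁ b₂ two : Bool) (j : ℕ) : Prog :=
  .seq (.push 2 b₁) (.seq (.push 2 b₂) (.seq (emitArg 8 j) (if two then emitArg 11 j else noop)))

theorem exec_emitGate (b₁ b₂ two : Bool) (p q j : ℕ) (base : Store) (a o l n : List Bool) :
    Exec (emitGate b₁ b₂ two j)
      (regs base a o l (List.replicate p true) (List.replicate q true) [] n)
      (4 * j + 10 * p + 10 * q + 23)
      (regs base a ((gateCode b₁ b₂ two p q j).reverse ++ o) l
        (List.replicate p true) (List.replicate q true) [] n) := by
  have hlast : Exec (if two then emitArg 11 j else noop)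
      (regs base a ((unary (j + p)).reverse ++ b₂ :: b₁ :: o) l (List.replicate p true)
        (List.replicate q true) [] n) (2 * j + 10 * q + 9)
      (regs base a ((gateCode b₁ b₂ two p q j).reverse ++ o) l
        (List.replicate p true) (List.replicate q true) [] n) := by
    cases two with
    | true =>
      simpa [gateCode] using exec_emitArg (q := 11) (by decide) (by decide) j q
        (regs base a ((unary (j + p)).reverse ++ b₂ :: b₁ :: o) l (List.replicate p true)
          (List.replicate q true) [] n) rfl rfl
    | false => simpa [gateCode] using (exec_noop _).mono (by omega)
  have h8 := exec_emitArg (q := 8) (by decide) (by decide) j p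
    (regs base a (b₂ :: b₁ :: o) l (List.replicate p true) (List.replicate q true) [] n) rfl rfl
  simp only [regs_2, update_regs_2] at h8
  have h := (Exec.push 2 b₁ (regs base a o l (List.replicate p true)
    (List.replicate q true) [] n)).seq ((Exec.push 2 b₂ _).seq (Exec.seq (by simpa using h8) hlast))
  exact h.mono (by omega)

/-- Write the copies `0, …, k - 1` of a gate, each of them twice, on stack 2, and count them on
stack 17. -/
def emitCopies (b₁ b₂ two : Bool) : ℕ → Prog
  | 0 => noop
  | j + 1 => .seq (emitCopies b₁ b₂ two j)
      (.seq (emitGate b₁ b₂ two j) (.seq (emitGate b₁ b₂ two j) (.push 17 true)))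

theorem exec_emitCopies (b₁ b₂ two : Bool) (p q k : ℕ) (base : Store) (a o l n : List Bool) :
    Exec (emitCopies b₁ b₂ two k)
      (regs base a o l (List.replicate p true) (List.replicate q true) [] n)
      (k * (8 * k + 20 * p + 20 * q + 50) + 3)
      (regs base a (((List.range k).flatMap fun j =>
          gateCode b₁ b₂ two p q j ++ gateCode b₁ b₂ two p q j).reverse ++ o) l
        (List.replicate p true) (List.replicate q true) [] (List.replicate k true ++ n)) := by
  induction k with
  | zero => exact (exec_noop _).congr (by simp) (by omega)
  | succ k ih =>
    have h := ih.seq ((exec_emitGate b₁ b₂ two p q k _ _ _ _ _).seq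
      ((exec_emitGate b₁ b₂ two p q k _ _ _ _ _).seq (Exec.push 17 true _)))
    refine h.congr ?_ ?_
    · simp [List.range_succ, List.replicate_succ]
    · nlinarith [Nat.zero_le k, Nat.zero_le p, Nat.zero_le q]

/-- Qubit `i` of copy `j` has index `k * i + j`; pushing `k` ones per unit read computes the part `k
* i` common to all copies. -/
theorem exec_readArg8 (k i : ℕ) (base : Store) (a o d e n : List Bool) :
    Exec (readUnary (pushOnes 8 k)) (regs base (unary i ++ a) o [] [] d e n)
      ((i + 1) * (2 * k + 9) + 2) (regs base a o [] (List.replicate (k * i) true) d e n) := by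
  refine exec_readUnary (fun i a l => regs base a o l (List.replicate (k * i) true) d e n)
    (by simp) (by simp) (by simp) (by simp) (fun i a l => ?_) i a
  convert exec_pushOnes 8 k _ using 1
  simp [Nat.mul_succ, Nat.add_comm (k * i)]

theorem exec_readArg11 (k i : ℕ) (base : Store) (a o b e n : List Bool) :
    Exec (readUnary (pushOnes 11 k)) (regs base (unary i ++ a) o [] b [] e n)
      ((i + 1) * (2 * k + 9) + 2) (regs base a o [] b (List.replicate (k * i) true) e n) := by
  refine exec_readUnary (fun i a l => regs base a o l b (List.replicate (k * i) true) e n)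
    (by simp) (by simp) (by simp) (by simp) (fun i a l => ?_) i a
  convert exec_pushOnes 11 k _ using 1
  simp [Nat.mul_succ, Nat.add_comm (k * i)]

/-- Process the arguments of a gate of kind `b₁, b₂`. -/
def gateArgs (k : ℕ) (b₁ b₂ two : Bool) : Prog :=
  .seq (readUnary (pushOnes 8 k)) (.seq (if two then readUnary (pushOnes 11 k) else noop)
    (.seq (emitCopies b₁ b₂ two k) (.seq (clear 8) (clear 11))))

/-- A gate with one argument is treated as having second argument 0, so that stack 11 stays empty
and both kinds share one statement. -/
theorem exec_gateArgs (k : ℕ) (b₁ b₂ two : Bool) (i i' : ℕ) (base : Store) (a o n : List Bool)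
    (hi' : two = false → i' = 0) :
    Exec (gateArgs k b₁ b₂ two)
      (regs base (unary i ++ ((if two then unary i' else []) ++ a)) o [] [] [] [] n)
      (100 * (k + 1) ^ 2 * (i + i' + 1))
      (regs base a (((List.range k).flatMap fun j => gateCode b₁ b₂ two (k * i) (k * i') j ++
          gateCode b₁ b₂ two (k * i) (k * i') j).reverse ++ o) [] [] [] []
        (List.replicate k true ++ n)) := by
  have h2 : Exec (if two then readUnary (pushOnes 11 k) else noop)
      (regs base ((if two then unary i' else []) ++ a) o [] (List.replicate (k * i) true) [] [] n)
      ((i' + 1) * (2 * k + 9) + 2)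
      (regs base a o [] (List.replicate (k * i) true) (List.replicate (k * i') true) [] n) := by
    cases two with
    | true => exact exec_readArg11 k i' _ _ _ _ _ _
    | false => simpa [hi' rfl] using (exec_noop _).mono (by omega)
  have h := (exec_readArg8 k i base _ o [] [] n).seq (h2.seq
    ((exec_emitCopies b₁ b₂ two (k * i) (k * i') k _ _ _ _ _).seq
      ((exec_clear 8 _ (k * i) (by simp)).seq (exec_clear 11 _ (k * i') (by simp)))))
  refine h.congr ?_ ?_
  · simp
  · nlinarith [Nat.zero_le (k * i), Nat.zero_le (k * i'), Nat.zero_le (k ^ 2 * i),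
      Nat.zero_le (k ^ 2 * i'), Nat.zero_le (k ^ 2)]

/-- Process one gate. -/
def gateProg (k : ℕ) : Prog :=
  .branch 0 noop
    (.seq (.pop 0) (.branch 0 noop (.seq (.pop 0) (gateArgs k false false false))
      (.seq (.pop 0) (gateArgs k false true false))))
    (.seq (.pop 0) (.branch 0 noop (.seq (.pop 0) (gateArgs k true false false))
      (.seq (.pop 0) (gateArgs k true true true))))

/-- Two nested branches decode the kind; only the kind 11, that is `CNOT`, takes two arguments. -/
theorem exec_gateProg (k : ℕ) (b₁ b₂ two : Bool) (h2 : two = (b₁ && b₂)) (i i' : ℕ)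
    (base : Store) (a o n : List Bool) (hi' : two = false → i' = 0) :
    Exec (gateProg k)
      (regs base (b₁ :: b₂ :: (unary i ++ ((if two then unary i' else []) ++ a))) o [] [] [] [] n)
      (100 * (k + 1) ^ 2 * (i + i' + 2))
      (regs base a (((List.range k).flatMap fun j => gateCode b₁ b₂ two (k * i) (k * i') j ++
          gateCode b₁ b₂ two (k * i) (k * i') j).reverse ++ o) [] [] [] []
        (List.replicate k true ++ n)) := by
  have h := exec_gateArgs k b₁ b₂ two i i' base a o n hi'
  set x := unary i ++ ((if two then unary i' else []) ++ a) with hx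
  set s' := regs base a (((List.range k).flatMap fun j =>
    gateCode b₁ b₂ two (k * i) (k * i') j ++
      gateCode b₁ b₂ two (k * i) (k * i') j).reverse ++ o) [] [] [] [] (List.replicate k true ++ n)
  have hpop : ∀ {p : Prog} {t : ℕ} (c : Bool) (y : List Bool),
      Exec p (regs base y o [] [] [] [] n) t s' →
      Exec (.seq (.pop 0) p) (regs base (c :: y) o [] [] [] [] n) (1 + t + 1) s' := fun c y hp =>
    (Exec.pop 0 _).seq (by simpa using hp)
  refine Exec.mono (t := 1 + (1 + 100 * (k + 1) ^ 2 * (i + i' + 1) + 1 + 1) + 1 + 1) ?_ ?_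
  · subst h2
    cases b₁ <;> cases b₂ <;>
    · refine Exec.branch (fun h => ?_) (fun l h => ?_) (fun l h => ?_) <;> simp at h
      refine hpop _ _ (Exec.branch (fun h => ?_) (fun l h => ?_) (fun l h => ?_)) <;> simp at h
      exact hpop _ _ (by assumption)
  · nlinarith [Nat.zero_le k, Nat.zero_le (k ^ 2)]

theorem Exec.length_le {p : Prog} {s s' : Store} {t : ℕ} (h : Exec p s t s') (k : ℕ) :
    (s' k).length ≤ (s k).length + t := by
  obtain ⟨t', h1, h2⟩ := h
  have h3 := length_foldl_step_le (List.replicate t' false) ([p], s) k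
  rw [h2 [] _ (by simp)] at h3
  simp only [List.length_replicate] at h3
  omega

/-! ### Parallel and duplicated circuits, and the program that writes their descriptions. -/

/-- A gate on copy `j` of a register of `n` qubits, in `k` interleaved copies. -/
def Gate.copy {n k : ℕ} (j : Fin k) : Gate n → Gate (n * k)
  | .H i => .H (finProdFinEquiv (i, j))
  | .X i => .X (finProdFinEquiv (i, j))
  | .T i => .T (finProdFinEquiv (i, j))
  | .CNOT c t hct => .CNOT (finProdFinEquiv (c, j)) (finProdFinEquiv (t, j))
      (fun e => hct (Prod.ext_iff.1 (finProdFinEquiv.injective e)).1)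

/-- `k` copies of a circuit on interleaved registers. -/
def Circuit.parallel {n : ℕ} (k : ℕ) (V : Circuit n) : Circuit (n * k) :=
  V.flatMap fun g => (List.finRange k).map fun j => g.copy j

/-- The random circuit whose gates do not depend on the random choices. -/
def Circuit.duplicate {w : ℕ} (G : Circuit w) : RandomCircuit w G.length :=
  fun j => (G.get j, G.get j)

theorem Circuit.encode_duplicate {w : ℕ} (G : Circuit w) :
    G.duplicate.encode = unary w ++ G.flatMap fun g => g.encode ++ g.encode := by
  have h : List.ofFn G.duplicate = G.map fun g => (g, g) := by
    conv_rhs => rw [← List.ofFn_get G, List.map_ofFn]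
    rfl
  rw [RandomCircuit.encode, h, List.flatMap_map]

theorem Circuit.length_parallel {n : ℕ} (k : ℕ) (V : Circuit n) :
    (V.parallel k).length = V.length * k := by
  simp [Circuit.parallel, List.length_flatMap]

theorem length_unary (k : ℕ) : (unary k).length = k + 1 := by simp [unary]

theorem flatMap_range_eq {α : Type*} (k : ℕ) (f : ℕ → List α) :
    (List.range k).flatMap f = (List.finRange k).flatMap fun j : Fin k => f j := by
  rw [← List.map_coe_finRange_eq_range, List.flatMap_map]

theorem exec_gate {n : ℕ} (k : ℕ) (g : Gate n) (base : Store) (a o c : List Bool) :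
    Exec (gateProg k) (regs base (g.encode ++ a) o [] [] [] [] c)
      (100 * (k + 1) ^ 2 * g.encode.length)
      (regs base a ((((List.finRange k).map fun j => g.copy j).flatMap fun g =>
        g.encode ++ g.encode).reverse ++ o) [] [] [] [] (List.replicate k true ++ c)) := by
  cases g with
  | H i =>
    have h := exec_gateProg k false false false rfl i 0 base a o c (by simp)
    refine (Exec.congr h ?_ ?_)
    · simp [flatMap_range_eq, List.flatMap_map, Gate.copy, Gate.encode, gateCode]
    · gcongr; simp [Gate.encode, length_unary]
  | X i =>
    have h := exec_gateProg k false true false rfl i 0 base a o c (by simp)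
    refine (Exec.congr h ?_ ?_)
    · simp [flatMap_range_eq, List.flatMap_map, Gate.copy, Gate.encode, gateCode]
    · gcongr; simp [Gate.encode, length_unary]
  | T i =>
    have h := exec_gateProg k true false false rfl i 0 base a o c (by simp)
    refine (Exec.congr h ?_ ?_)
    · simp [flatMap_range_eq, List.flatMap_map, Gate.copy, Gate.encode, gateCode]
    · gcongr; simp [Gate.encode, length_unary]
  | CNOT i i' hi =>
    have h := exec_gateProg k true true true rfl i i' base a o c (by simp)
    simp only [Gate.encode, List.cons_append, List.append_assoc]
    refine (Exec.congr h ?_ ?_)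
    · simp [flatMap_range_eq, List.flatMap_map, Gate.copy, gateCode]
    · gcongr; simp [length_unary]; omega

theorem exec_gates {n : ℕ} (k : ℕ) (V : Circuit n) (base : Store) (o c : List Bool) :
    Exec (.loop 0 (gateProg k)) (regs base (V.flatMap Gate.encode) o [] [] [] [] c)
      ((100 * (k + 1) ^ 2 + 1) * (V.flatMap Gate.encode).length + 1)
      (regs base [] (((V.parallel k).flatMap fun g => g.encode ++ g.encode).reverse ++ o)
        [] [] [] [] (List.replicate (V.length * k) true ++ c)) := by
  induction V generalizing o c with
  | nil => exact (Exec.loop_nil rfl).congr (by simp [Circuit.parallel]) (by simp)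
  | cons g V ih =>
    have hg : g.encode ≠ [] ∧ 1 ≤ g.encode.length := by cases g <;> simp [Gate.encode]
    refine (Exec.loop_cons ?_ (exec_gate k g base (V.flatMap Gate.encode) o c) (ih _ _)).congr ?_ ?_
    · simp [hg.1]
    · simp only [Circuit.parallel, List.flatMap_cons, List.flatMap_append, List.reverse_append,
        List.append_assoc, List.length_cons]
      rw [Nat.succ_mul, List.replicate_add, List.append_assoc]
    · simp only [List.flatMap_cons, List.length_append]
      nlinarith [hg.2]

/-- From the description of a circuit on stack 0, produce the description of the duplicate of its
parallel circuit on stack 1, and the number of qubits of the latter in unary on stack 17. -/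
def transform (k : ℕ) : Prog :=
  .seq (readUnary (.seq (pushOnes 2 k) (pushOnes 17 k)))
    (.seq (.push 2 false) (.seq (.loop 0 (gateProg k)) flush))

theorem exec_transform {n : ℕ} (k : ℕ) (V : Circuit n) (base : Store) :
    Exec (transform k) (regs base (encodeCircuit V) [] [] [] [] [] [])
      (6 * ((200 * (k + 1) ^ 2) * (encodeCircuit V).length + 10))
      (Function.update (regs base [] [] [] [] [] []
        (List.replicate (n * k + (V.parallel k).length) true)) 1
        ((V.parallel k).duplicate.encode ++ base 1)) := by
  have h1 := exec_readUnary (p := .seq (pushOnes 2 k) (pushOnes 17 k))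
    (fun i a l => regs base a (List.replicate (i * k) true) l [] [] []
      (List.replicate (i * k) true)) (by simp) (by simp) (by simp) (by simp)
    (fun i a l => ((exec_pushOnes 2 k _).seq (exec_pushOnes 17 k _)).congr
      (by simp [Nat.succ_mul, Nat.add_comm (i * k)]) le_rfl) n (V.flatMap Gate.encode)
  have h2 := Exec.push 2 false (regs base (V.flatMap Gate.encode) (List.replicate (n * k) true) []
    [] [] [] (List.replicate (n * k) true))
  simp only [regs_2, update_regs_2] at h2
  have h3 := exec_gates k V base (false :: List.replicate (n * k) true)
    (List.replicate (n * k) true)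
  -- The cost of `flush` is linear in the height of stack 2, and a stack grows by at most one bit
  -- per step, so the time spent so far bounds that height. With 5 steps per flushed bit this yields
  -- the factor 6.
  have h123 := (h1.seq (h2.seq h3)).length_le 2
  simp only [regs_2, Nat.zero_mul, List.replicate_zero, List.length_nil, Nat.zero_add] at h123
  have h4 := exec_flush _ (regs base [] (((V.parallel k).flatMap fun g =>
    g.encode ++ g.encode).reverse ++ (false :: List.replicate (n * k) true)) [] [] [] []
      (List.replicate (V.length * k) true ++ List.replicate (n * k) true)) rfl
  rw [regs_2] at h4
  have h := h1.seq (h2.seq (h3.seq h4))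
  simp only [Nat.zero_mul, List.replicate_zero] at h
  refine h.congr ?_ ?_
  · rw [update_regs_2, ← List.replicate_add, Nat.add_comm (V.length * k),
      ← Circuit.length_parallel, Circuit.encode_duplicate]
    simp [unary, regs]
  · have hl : (encodeCircuit V).length = n + 1 + (V.flatMap Gate.encode).length := by
      simp [encodeCircuit, length_unary]
    rw [hl]
    set L := (V.flatMap Gate.encode).length
    have hX : (n + 1) * (2 * k + 3 + (2 * k + 3) + 1 + 6) + 2 +
        (1 + ((100 * (k + 1) ^ 2 + 1) * L + 1) + 1) + 1 ≤
        (200 * (k + 1) ^ 2) * (n + 1 + L) + 6 := by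
      nlinarith [Nat.zero_le (k * n), Nat.zero_le (k * k * n), Nat.zero_le (k * L),
        Nat.zero_le (k * k * L), Nat.zero_le (k * k)]
    omega

/-! ### Checking the sample -/

/-- Decide whether the stacks 1 and 17 have the same height. -/
def lengthCheck : Prog :=
  .seq (.push 0 true) (.seq (.loop 17 (.seq (.pop 17) (.branch 1 (.push 0 false) (.pop 1) (.pop 1))))
    (.branch 1 noop (.push 0 false) (.push 0 false)))

/-- Only the top of stack 0 matters: a round that finds stack 1 empty pushes a 0, and stack 1 stays
empty from then on, so a failure is never undone. -/
theorem exec_lengthCheck_loop (c : ℕ) (s : Store) (b : Bool) (hc : (s 17).length = c)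
    (hb : (s 0).head? = some b) : ∃ s',
    Exec (.loop 17 (.seq (.pop 17) (.branch 1 (.push 0 false) (.pop 1) (.pop 1)))) s (5 * c + 1) s' ∧
      (s' 0).head? = some (b && decide (c ≤ (s 1).length)) ∧ s' 1 = (s 1).drop c := by
  induction c generalizing s b with
  | zero => exact ⟨s, Exec.loop_nil (List.length_eq_zero_iff.1 hc), by simp [hb], by simp⟩
  | succ c ih =>
    have hne : s 17 ≠ [] := by intro h; simp [h] at hc
    rcases h : s 1 with _ | ⟨x, l⟩
    · obtain ⟨s', h1, h2, h3⟩ := ih (Function.update (Function.update s 17 (s 17).tail) 0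
        (false :: s 0)) false (by simp [hc]) (by simp)
      refine ⟨s', (Exec.loop_cons hne ((Exec.pop 17 s).seq (Exec.branch (t := 1) (fun _ =>
        (Exec.push 0 false _).congr (by simp) le_rfl) ?_ ?_)) h1).mono (by omega), ?_, ?_⟩
      · intro l hl; simp [h] at hl
      · intro l hl; simp [h] at hl
      · simp [h2]
      · simp [h3, h]
    · obtain ⟨s', h1, h2, h3⟩ := ih (Function.update (Function.update s 17 (s 17).tail) 1 l) b
        (by simp [hc]) (by simpa using hb)
      refine ⟨s', (Exec.loop_cons hne ((Exec.pop 17 s).seq (Exec.branch (t := 1) ?_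
        (fun _ _ => (Exec.pop 1 _).congr (by simp [h]) le_rfl)
        (fun _ _ => (Exec.pop 1 _).congr (by simp [h]) le_rfl))) h1).mono (by omega), ?_, ?_⟩
      · intro hl; simp [h] at hl
      · simp [h2]
      · simp [h3]

/-- The flag left by the loop says that stack 1 was high enough; an empty remainder on stack 1 says
that it was not too high. -/
theorem exec_lengthCheck (s : Store) : ∃ s', Exec lengthCheck s (5 * (s 17).length + 8) s' ∧
    (s' 0).head? = some (decide ((s 1).length = (s 17).length)) := by
  obtain ⟨s', h1, h2, h3⟩ := exec_lengthCheck_loop (s 17).length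
    (Function.update s 0 (true :: s 0)) true (by simp) (by simp)
  simp only [Function.update_of_ne (show (1 : ℕ) ≠ 0 by decide), Bool.true_and] at h2 h3
  have hd : (s' 1).length = (s 1).length - (s 17).length := by rw [h3]; simp
  rcases h : s' 1 with _ | ⟨x, l⟩
  · refine ⟨s', ((Exec.push 0 true s).seq (h1.seq (Exec.branch (t := 3)
      (fun _ => exec_noop s') ?_ ?_))).mono (by omega), ?_⟩
    · intro l hl; simp [h] at hl
    · intro l hl; simp [h] at hl
    · rw [h2]
      rw [h, List.length_nil] at hd
      congr 2
      exact propext ⟨fun _ => by omega, fun _ => by omega⟩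
  · refine ⟨_, ((Exec.push 0 true s).seq (h1.seq (Exec.branch (t := 1) ?_
      (fun _ _ => Exec.push 0 false s') (fun _ _ => Exec.push 0 false s')))).mono (by omega), ?_⟩
    · intro hl; simp [h] at hl
    · rw [h, List.length_cons] at hd
      have : (s 1).length ≠ (s 17).length := by omega
      simp [this]

/-- Decide whether stack 1 starts with `k` ones and is as high as stack 17. -/
def sampleCheck : ℕ → Prog
  | 0 => lengthCheck
  | k + 1 => .branch 1 (.push 0 false) (.push 0 false)
      (.seq (.pop 1) (.seq (.pop 17) (sampleCheck k)))

/-- Each 1 removed from stack 1 is matched by a bit removed from stack 17, so comparing the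
remaining heights compares the original ones. `hk` ensures that stack 17 is not popped when empty.
-/
theorem exec_sampleCheck (k : ℕ) (s : Store) (hk : k ≤ (s 17).length) : ∃ s',
    Exec (sampleCheck k) s (5 * (s 17).length + 8) s' ∧ (s' 0).head? =
      some (decide ((s 1).take k = List.replicate k true ∧ (s 1).length = (s 17).length)) := by
  induction k generalizing s with
  | zero =>
    obtain ⟨s', h1, h2⟩ := exec_lengthCheck s
    exact ⟨s', h1, by simpa using h2⟩
  | succ k ih =>
    rcases h : s 1 with _ | ⟨_ | _, l⟩
    · refine ⟨_, (Exec.branch (t := 1) (fun _ => Exec.push 0 false s) ?_ ?_).mono (by omega), ?_⟩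
      · intro l hl; simp [h] at hl
      · intro l hl; simp [h] at hl
      · simp [List.replicate_succ]
    · refine ⟨_, (Exec.branch (t := 1) ?_ (fun _ _ => Exec.push 0 false s) ?_).mono (by omega), ?_⟩
      · intro hl; simp [h] at hl
      · intro l hl; simp [h] at hl
      · simp [List.replicate_succ]
    · obtain ⟨s', h1, h2⟩ := ih (Function.update (Function.update s 1 l) 17 (s 17).tail)
        (by simp; omega)
      have hp := (Exec.pop 1 s).seq ((Exec.pop 17 _).seq (q := sampleCheck k) (s₂ := s')
        (t₂ := 5 * ((s 17).length - 1) + 8) (by simpa [h] using h1))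
      refine ⟨s', (Exec.branch ?_ ?_ (fun _ _ => hp)).mono (by omega), ?_⟩
      · intro hl; simp [h] at hl
      · intro l hl; simp [h] at hl
      · rw [h2]
        simp only [Function.update_self, List.length_tail, List.length_cons, List.take_succ_cons,
          List.replicate_succ, List.cons.injEq, true_and,
          Function.update_of_ne (show (1 : ℕ) ≠ 17 by decide)]
        congr 3
        exact propext ⟨fun _ => by omega, fun _ => by omega⟩

/-! ### Product states -/

/-- The product of states on the `k` interleaved copies of a register. -/
def productState {n k : ℕ} (φ : Fin k → QState n) : QState (n * k) :=
  fun z => ∏ j, φ j fun i => z (finProdFinEquiv (i, j))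

theorem update_copy {n k : ℕ} (z : Fin (n * k) → Bool) (i : Fin n) (j j' : Fin k) (b : Bool) :
    (fun i' => Function.update z (finProdFinEquiv (i, j)) b (finProdFinEquiv (i', j'))) =
      if j' = j then Function.update (fun i' => z (finProdFinEquiv (i', j'))) i b
      else fun i' => z (finProdFinEquiv (i', j')) := by
  ext1 i'
  split_ifs with h
  · subst h; simp [Function.update_apply]
  · simp [h]

theorem prod_update_copy {n k : ℕ} (φ : Fin k → QState n) (z : Fin (n * k) → Bool) (i : Fin n)
    (j : Fin k) (b : Bool) :
    productState φ (Function.update z (finProdFinEquiv (i, j)) b) =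
      φ j (Function.update (fun i' => z (finProdFinEquiv (i', j))) i b) *
        ∏ j' ∈ Finset.univ.erase j, φ j' fun i => z (finProdFinEquiv (i, j')) := by
  rw [productState, ← Finset.mul_prod_erase _ _ (Finset.mem_univ j)]
  congr 1
  · rw [update_copy, if_pos rfl]
  · refine Finset.prod_congr rfl fun j' hj' => ?_
    rw [update_copy, if_neg (Finset.ne_of_mem_erase hj')]

theorem productState_update {n k : ℕ} (φ : Fin k → QState n) (j : Fin k) (ψ : QState n)
    (z : Fin (n * k) → Bool) :
    productState (Function.update φ j ψ) z = ψ (fun i => z (finProdFinEquiv (i, j))) *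
      ∏ j' ∈ Finset.univ.erase j, φ j' fun i => z (finProdFinEquiv (i, j')) := by
  rw [productState, ← Finset.mul_prod_erase _ _ (Finset.mem_univ j)]
  congr 1
  · simp
  · refine Finset.prod_congr rfl fun j' hj' => ?_
    rw [Function.update_of_ne (Finset.ne_of_mem_erase hj')]

/-- Changing a bit of copy `j` changes only the `j`-th factor of the product; the other factors come
out of the sum over that bit. -/
theorem apply_copy {n k : ℕ} (g : Gate n) (j : Fin k) (φ : Fin k → QState n) :
    (g.copy j).apply (productState φ) = productState (Function.update φ j (g.apply (φ j))) := by
  have h1 : ∀ (U : Matrix Bool Bool ℂ) (i : Fin n),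
      applyOne U (finProdFinEquiv (i, j)) (productState φ) =
        productState (Function.update φ j (applyOne U i (φ j))) := fun U i => by
    ext1 z
    simp only [applyOne, prod_update_copy, productState_update, Finset.sum_mul, mul_assoc]
  cases g with
  | H i => exact h1 _ i
  | X i => exact h1 _ i
  | T i => exact h1 _ i
  | CNOT c t hct =>
    ext1 z
    simp only [Gate.copy, Gate.apply, prod_update_copy, productState_update]

theorem foldl_copy {n k : ℕ} (g : Gate n) (l : List (Fin k)) (hl : l.Nodup)
    (φ : Fin k → QState n) :
    (l.map fun j => g.copy j).foldl (fun ψ g => g.apply ψ) (productState φ) =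
      productState fun j => if j ∈ l then g.apply (φ j) else φ j := by
  induction l generalizing φ with
  | nil => simp
  | cons j l ih =>
    rw [List.nodup_cons] at hl
    rw [List.map_cons, List.foldl_cons, apply_copy, ih hl.2]
    congr 1
    ext1 j'
    by_cases h : j' = j
    · subst h; simp [hl.1]
    · simp [h]

theorem finalState_parallel {n : ℕ} (k : ℕ) (V : Circuit n) :
    finalState (V.parallel k) = productState fun _ => finalState V := by
  have h0 : zeroState (n * k) = productState fun _ => zeroState n := by
    ext1 z
    simp only [zeroState, productState, Finset.prod_ite_zero, Finset.prod_const_one]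
    congr 1
    refine propext ⟨fun h j _ => by rw [h], fun h => ?_⟩
    ext1 i
    obtain ⟨⟨i, j⟩, rfl⟩ := finProdFinEquiv.surjective i
    exact congrFun (h j (Finset.mem_univ j)) i
  have key : ∀ ψ : QState n, (V.parallel k).foldl (fun ψ g => g.apply ψ) (productState fun _ => ψ) =
      productState fun _ => V.foldl (fun ψ g => g.apply ψ) ψ := by
    induction V with
    | nil => intro ψ; rfl
    | cons g V ih =>
      intro ψ
      rw [Circuit.parallel, List.flatMap_cons, List.foldl_append,
        foldl_copy g _ (List.nodup_finRange k)]
      simp only [List.mem_finRange, if_true]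
      exact ih (g.apply ψ)
  rw [finalState, h0, key]
  rfl

/-! ### Ancillas and the output distribution of a duplicated circuit. -/

/-- The state of a main register in state `ψ` and an ancilla register in the basis state `β`. -/
def withAncillas {w m : ℕ} (ψ : QState w) (β : Fin m → Bool) : QState (w + m) :=
  fun z => ψ (fun i => z (Fin.castAdd m i)) * if (fun i => z (Fin.natAdd w i)) = β then 1 else 0

theorem castAdd_ne_natAdd {w m : ℕ} (i : Fin w) (j : Fin m) : Fin.castAdd m i ≠ Fin.natAdd w j := by
  intro h
  have := congrArg Fin.val h
  simp at this
  omega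

theorem withAncillas_update {w m : ℕ} (ψ : QState w) (β : Fin m → Bool) (z : Fin (w + m) → Bool)
    (i : Fin w) (b : Bool) :
    withAncillas ψ β (Function.update z (Fin.castAdd m i) b) =
      ψ (Function.update (fun i => z (Fin.castAdd m i)) i b) *
        if (fun i => z (Fin.natAdd w i)) = β then 1 else 0 := by
  have h1 : (fun i' => Function.update z (Fin.castAdd m i) b (Fin.castAdd m i')) =
      Function.update (fun i => z (Fin.castAdd m i)) i b := by
    ext1 i'; simp [Function.update_apply]
  have h2 : (fun i' => Function.update z (Fin.castAdd m i) b (Fin.natAdd w i')) =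
      fun i => z (Fin.natAdd w i) := by
    ext1 i'; simp [(castAdd_ne_natAdd i i').symm]
  rw [withAncillas, h1, h2]

theorem apply_extend {w m : ℕ} (g : Gate w) (ψ : QState w) (β : Fin m → Bool) :
    (g.extend m).apply (withAncillas ψ β) = withAncillas (g.apply ψ) β := by
  have h1 : ∀ (U : Matrix Bool Bool ℂ) (i : Fin w),
      applyOne U (Fin.castAdd m i) (withAncillas ψ β) = withAncillas (applyOne U i ψ) β :=
    fun U i => by
      ext1 z
      simp only [applyOne, withAncillas_update]
      rw [withAncillas, applyOne, Finset.sum_mul]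
      simp only [mul_assoc]
  cases g with
  | H i => exact h1 _ i
  | X i => exact h1 _ i
  | T i => exact h1 _ i
  | CNOT c t hct =>
    ext1 z
    simp only [Gate.extend, Gate.apply, withAncillas_update]
    rfl

theorem apply_X_ancilla {w m : ℕ} (j : Fin m) (ψ : QState w) (β : Fin m → Bool) :
    (Gate.X (Fin.natAdd w j)).apply (withAncillas ψ β) =
      withAncillas ψ (Function.update β j (!β j)) := by
  ext1 z
  have h1 : ∀ b, (fun i' => Function.update z (Fin.natAdd w j) b (Fin.castAdd m i')) =
      fun i => z (Fin.castAdd m i) := fun b => by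
    ext1 i'; simp [castAdd_ne_natAdd i' j]
  have h2 : ∀ b, (fun i' => Function.update z (Fin.natAdd w j) b (Fin.natAdd w i')) =
      Function.update (fun i => z (Fin.natAdd w i)) j b := fun b => by
    ext1 i'; simp [Function.update_apply]
  have h3 : Function.update (fun i => z (Fin.natAdd w i)) j (!z (Fin.natAdd w j)) = β ↔
      (fun i => z (Fin.natAdd w i)) = Function.update β j (!β j) := by
    constructor
    · rintro rfl; simp
    · intro h
      have hj := congrFun h j
      simp only [Function.update_self] at hj
      rw [h, hj]; simp
  have h4 : (Gate.X (Fin.natAdd w j)).apply (withAncillas ψ β) z =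
      withAncillas ψ β (Function.update z (Fin.natAdd w j) (!z (Fin.natAdd w j))) := by
    simp only [Gate.apply, applyOne, xMat, Fintype.sum_bool]
    cases z (Fin.natAdd w j) <;> simp
  rw [h4, withAncillas, withAncillas, h1, h2]
  simp only [h3]

/-- Both choices apply the same `g j`, so `α` influences only the ancillas. The list has no
repetitions, so each ancilla is flipped at most once. -/
theorem foldl_realize {w m : ℕ} (g : Fin m → Gate w) (α : Fin m → Bool) (l : List (Fin m))
    (hl : l.Nodup) (ψ : QState w) (β : Fin m → Bool) :
    (l.map fun j => if α j then [(g j).extend m, Gate.X (Fin.natAdd w j)]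
      else [(g j).extend m]).flatten.foldl (fun ψ g => g.apply ψ) (withAncillas ψ β) =
      withAncillas ((l.map g).foldl (fun ψ g => g.apply ψ) ψ)
        fun j => if j ∈ l then xor (α j) (β j) else β j := by
  induction l generalizing ψ β with
  | nil => simp
  | cons j l ih =>
    rw [List.nodup_cons] at hl
    have hs : (if α j then [(g j).extend m, Gate.X (Fin.natAdd w j)] else [(g j).extend m]).foldl
        (fun ψ g => g.apply ψ) (withAncillas ψ β) =
        withAncillas ((g j).apply ψ) (Function.update β j (xor (α j) (β j))) := by
      cases α j
      · simp [apply_extend]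
      · simp [apply_extend, apply_X_ancilla]
    rw [List.map_cons, List.flatten_cons, List.foldl_append, hs, ih hl.2, List.map_cons,
      List.foldl_cons]
    congr 1
    ext1 j'
    by_cases h : j' = j
    · subst h; simp [hl.1]
    · simp [h]

theorem finalState_realize_duplicate {w : ℕ} (G : Circuit w) (α : Fin G.length → Bool) :
    finalState (G.duplicate.realize α) = withAncillas (finalState G) α := by
  have h0 : zeroState (w + G.length) = withAncillas (zeroState w) fun _ => false := by
    ext1 z
    simp only [zeroState, withAncillas, ite_mul, one_mul, zero_mul, ← ite_and]
    congr 1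
    refine propext ⟨fun h => by simp [h], fun ⟨h1, h2⟩ => ?_⟩
    ext1 i
    refine Fin.addCases (fun i => congrFun h1 i) (fun i => congrFun h2 i) i
  have h := foldl_realize (m := G.length) (fun j => G.get j) α _ (List.nodup_finRange _)
    (zeroState w) fun _ => false
  rw [finalState, h0, RandomCircuit.realize, List.ofFn_eq_map]
  refine h.trans ?_
  have hG : (List.finRange G.length).map (fun j => G.get j) = G := by
    rw [← List.ofFn_eq_map]; exact List.ofFn_get G
  rw [hG]
  simp [finalState]

/-- The ancillas record `α` exactly, so a given outcome `z` is compatible with a single `α`. -/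
theorem idealProb_duplicate {w : ℕ} (G : Circuit w) (z : Fin (w + G.length) → Bool) :
    G.duplicate.idealProb z = measureProb G (fun i => z (Fin.castAdd _ i)) / 2 ^ G.length := by
  rw [RandomCircuit.idealProb]
  congr 1
  have h : ∀ α : Fin G.length → Bool, measureProb (G.duplicate.realize α) z =
      if (fun i => z (Fin.natAdd w i)) = α then measureProb G (fun i => z (Fin.castAdd _ i))
      else 0 := fun α => by
    rw [measureProb, finalState_realize_duplicate, withAncillas]
    split_ifs <;> simp [measureProb]
  simp only [h, Finset.sum_ite_eq, Finset.mem_univ, if_true]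

/-! ### The probability that all copies accept -/

/-- Independence of the copies: expanding the `k`-th power gives a sum over `k`-tuples of outcomes,
which are the outcomes of the interleaved register. -/
theorem sum_copies {n k : ℕ} (f : (Fin (n + 1) → Bool) → ℝ) :
    ∑ y ∈ Finset.univ.filter (fun y : Fin ((n + 1) * k) → Bool =>
        ∀ j : Fin k, y (finProdFinEquiv (0, j)) = true),
      ∏ j : Fin k, f (fun i => y (finProdFinEquiv (i, j))) =
    (∑ y ∈ Finset.univ.filter (fun y : Fin (n + 1) → Bool => y 0 = true), f y) ^ k := by
  have h := Finset.prod_univ_sum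
    (fun _ : Fin k => Finset.univ.filter fun y : Fin (n + 1) → Bool => y 0 = true) fun _ => f
  rw [Finset.prod_const, Finset.card_univ, Fintype.card_fin] at h
  rw [h]
  refine Finset.sum_nbij' (fun y j i => y (finProdFinEquiv (i, j)))
    (fun x a => x (finProdFinEquiv.symm a).2 (finProdFinEquiv.symm a).1) ?_ ?_ ?_ ?_ ?_
  · intro y hy; simpa using hy
  · intro x hx
    simp only [Finset.mem_filter, Finset.mem_univ, true_and, Equiv.symm_apply_apply]
    simpa using hx
  · intro y _; ext1 a; simp only [Prod.mk.eta, Equiv.apply_symm_apply]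
  · intro x _; ext j i; simp only [Equiv.symm_apply_apply]
  · intro y _; rfl

/-- The outcomes for which all copies of the first qubit are 1. -/
def acceptSet (n k m : ℕ) : Finset (Fin ((n + 1) * k + m) → Bool) :=
  Finset.univ.filter fun z => ∀ j : Fin k, z (Fin.castAdd m (finProdFinEquiv (0, j))) = true

theorem sum_acceptSet {n k m : ℕ} (f : (Fin (n + 1) → Bool) → ℝ) :
    ∑ z ∈ acceptSet n k m, ∏ j : Fin k, f (fun i => z (Fin.castAdd m (finProdFinEquiv (i, j)))) =
    2 ^ m * (∑ y ∈ Finset.univ.filter (fun y : Fin (n + 1) → Bool => y 0 = true), f y) ^ k := by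
  rw [← sum_copies, acceptSet, Finset.sum_filter, Finset.sum_filter,
    ← (Fin.appendEquiv ((n + 1) * k) m).sum_comp, Fintype.sum_prod_type]
  simp [Fin.appendEquiv, Finset.mul_sum]

theorem card_first_true (n : ℕ) :
    (Finset.univ.filter fun y : Fin (n + 1) → Bool => y 0 = true).card = 2 ^ n := by
  have h : Fintype.card (Fin n → Bool) = 2 ^ n := by simp
  rw [← Fintype.card_subtype, ← h]
  refine Fintype.card_congr ⟨fun y i => y.1 i.succ, fun y => ⟨Fin.cons true y, rfl⟩, ?_, ?_⟩
  · rintro ⟨y, hy⟩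
    ext i
    refine Fin.cases ?_ (fun i => ?_) i <;> simp [hy]
  · intro y; rfl

/-- The event leaves the ancillas free, so their `2 ^ m` values cancel the factor `1 / 2 ^ m` in the
ideal part; in the noise part the event is a fraction `2 ^ (-k)` of all outcomes. -/
theorem sum_depolarizedProb {n : ℕ} (k : ℕ) (F : ℝ) (V : Circuit (n + 1)) :
    ∑ z ∈ acceptSet n k (V.parallel k).length, (V.parallel k).duplicate.depolarizedProb F z =
      F * circuitAcceptProb V ^ k + (1 - F) / 2 ^ k := by
  set m := (V.parallel k).length
  have h1 := sum_acceptSet (k := k) (m := m) (measureProb V)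
  -- Taking `f = 1` counts the event itself.
  have h2 := sum_acceptSet (n := n) (k := k) (m := m) fun _ => 1
  simp only [Finset.prod_const_one, Finset.sum_const, nsmul_eq_mul, mul_one, card_first_true] at h2
  have h3 : ∀ z, (V.parallel k).duplicate.depolarizedProb F z = F / 2 ^ m * (∏ j : Fin k,
      measureProb V fun i => z (Fin.castAdd m (finProdFinEquiv (i, j)))) +
      (1 - F) / 2 ^ ((n + 1) * k + m) := fun z => by
    rw [RandomCircuit.depolarizedProb, idealProb_duplicate]
    simp only [measureProb, finalState_parallel, productState, norm_prod, Finset.prod_pow]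
    ring
  simp only [h3]
  rw [Finset.sum_add_distrib, ← Finset.mul_sum, h1, Finset.sum_const, nsmul_eq_mul, h2,
    circuitAcceptProb]
  push_cast
  field_simp
  ring

/-! ### The SBP machine -/

/-- The middle block is the sampler's share of the coins; the coins of the other phases are
irrelevant and cancel in the probability. -/
theorem card_filter_middle (a b c : ℕ) (P : (Fin b → Bool) → Prop) [DecidablePred P] :
    (Finset.univ.filter fun r : Fin (a + b + c) → Bool =>
      P fun i => r (Fin.castAdd c (Fin.natAdd a i))).card =
      2 ^ a * (Finset.univ.filter P).card * 2 ^ c := by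
  simp only [Finset.card_filter]
  rw [← (Fin.appendEquiv (a + b) c).sum_comp, Fintype.sum_prod_type,
    ← (Fin.appendEquiv a b).sum_comp, Fintype.sum_prod_type]
  simp only [Fin.appendEquiv, Equiv.coe_fn_mk, Fin.append_left, Fin.append_right,
    Finset.sum_const, Finset.card_univ, Fintype.card_fun, Fintype.card_fin, Fintype.card_bool,
    smul_eq_mul, ← Finset.mul_sum]
  ring

/-- A deterministic preparation, then a probabilistic program on its own stacks `3 i + 1`, then the
check of its output. -/
theorem machineAcceptProb_sample {pre S : Prog} {x e : List Bool} {s : Store} {t tS T k N : ℕ}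
    (hpre : Exec pre (init pre x).2 t s) (he : s 1 = e) (hs : ∀ i, s (3 * (i + 1) + 1) = [])
    (hN : (s 17).length = N) (hk : k ≤ N) (hS : HaltsWithin S e tS)
    (hT : t + tS + 5 * N + 10 ≤ T) :
    HaltsWithin (.seq pre (.seq (S.rename fun i => 3 * i + 1) (sampleCheck k))) x T ∧
    machineAcceptProb (.seq pre (.seq (S.rename fun i => 3 * i + 1) (sampleCheck k))) x T =
      ((Finset.univ.filter fun r : Fin tS → Bool => ∃ y, result S e r = some y ∧
        y.take k = List.replicate k true ∧ y.length = N).card : ℝ) / 2 ^ tS := by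
  classical
  set p := Prog.seq pre (.seq (S.rename fun i => 3 * i + 1) (sampleCheck k)) with hp
  obtain ⟨t', ht', hrun⟩ := hpre
  -- The preparation takes `t'` steps, and unfolding the two `seq` takes 2 more. The remaining `c`
  -- steps are at least the `5 * N + 8` that the final check may need.
  obtain ⟨c, rfl⟩ : ∃ c, T = t' + 2 + tS + c := ⟨T - (t' + 2 + tS), by omega⟩
  have hf : Function.Injective fun i : ℕ => 3 * i + 1 := fun i j h => by simpa using h
  have hsf : s ∘ (fun i : ℕ => 3 * i + 1) = Function.update (fun _ => []) 0 e := by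
    ext1 i
    rcases i with _ | i
    · simpa using he
    · simpa using hs i
  have key : ∀ r : Fin (t' + 2 + tS + c) → Bool, ∃ y v,
      result S e (fun i => r (Fin.castAdd c (Fin.natAdd (t' + 2) i))) = some y ∧
      result p x r = some v ∧
      v.head? = some (decide (y.take k = List.replicate k true ∧ y.length = N)) := by
    intro r
    set B := List.ofFn fun i => r (Fin.castAdd c (Fin.natAdd (t' + 2) i)) with hB
    obtain ⟨A, D, hr, hA, hD⟩ : ∃ A D, List.ofFn r = A ++ (B ++ D) ∧ A.length = t' + 2 ∧
        D.length = c :=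
      ⟨List.ofFn fun i => r (Fin.castAdd c (Fin.castAdd tS i)), List.ofFn fun i => r (Fin.natAdd _ i),
        by rw [List.ofFn_add, List.ofFn_add, List.append_assoc]; rfl, by simp, by simp⟩
    have h1 : A.foldl step (init p x) =
        ([S.rename fun i => 3 * i + 1, sampleCheck k], s) := by
      rcases A with _ | ⟨b, A⟩
      · simp at hA
      rcases List.eq_nil_or_concat A with rfl | ⟨A, b', rfl⟩
      · simp at hA
      have := hrun [.seq (S.rename fun i => 3 * i + 1) (sampleCheck k)] A (by simpa using hA)
      rw [List.foldl_cons, List.concat_eq_append, List.foldl_append]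
      simp only [init, hp, step] at this ⊢
      rw [this]
      rfl
    have hhalt := hS fun i => r (Fin.castAdd c (Fin.natAdd (t' + 2) i))
    obtain ⟨f1, f2, f3⟩ := foldl_step_rename hf B [S] s
    rw [hsf] at f1 f2
    rcases hQ : B.foldl step ([S], Function.update (fun _ => []) 0 e) with ⟨l, q⟩
    have hres : result S e (fun i => r (Fin.castAdd c (Fin.natAdd (t' + 2) i))) =
        output (l, q) := by
      rw [result, ← hB, ← hQ]; rfl
    rw [hres] at hhalt
    rcases l with _ | ⟨_, _⟩
    swap
    · simp [output] at hhalt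
    rw [hQ] at f1 f2
    -- The sampler may halt early, at a time depending on its coins. The check then starts on the
    -- leftover coins `r₁`, which is harmless as it ignores coins.
    obtain ⟨r₀, r₁, hr01, hc⟩ := exists_prefix_of_halted B _ s f1
    set s₂ := (B.foldl step ([S].map (Prog.rename fun i => 3 * i + 1), s)).2 with hs₂
    have h17 : (s₂ 17).length = N := by rw [f3 17 (fun j => by omega), hN]
    have hq : s₂ 1 = q 0 := congrFun f2 0
    obtain ⟨s₃, ⟨t₃, ht₃, hrun₃⟩, hhead⟩ := exec_sampleCheck k s₂ (by omega)
    refine ⟨q 0, s₃ 0, by rw [hres]; rfl, ?_, ?_⟩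
    · have h2 : (r₁ ++ D).foldl step ([sampleCheck k], s₂) = ([], s₃) := by
        rw [← List.take_append_drop t₃ (r₁ ++ D), List.foldl_append,
          hrun₃ [] _ (by simp; omega), foldl_step_nil]
      have h3 := hc [sampleCheck k]
      simp only [List.map_cons, List.map_nil, List.cons_append, List.nil_append] at h3
      rw [result, hr, List.foldl_append, h1, hr01, List.append_assoc, List.foldl_append, h3]
      erw [h2]
      rfl
    · rw [hhead, hq, h17]
  refine ⟨fun r => ?_, ?_⟩
  · obtain ⟨y, v, -, hv, -⟩ := key r
    rw [hv]; rfl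
  · have hiff : ∀ r : Fin (t' + 2 + tS + c) → Bool, (result p x r).bind List.head? = some true ↔
        ∃ y, result S e (fun i => r (Fin.castAdd c (Fin.natAdd (t' + 2) i))) = some y ∧
          y.take k = List.replicate k true ∧ y.length = N := by
      intro r
      obtain ⟨y, v, hy, hv, hh⟩ := key r
      simp [hv, hy, hh]
    rw [machineAcceptProb]
    simp only [hiff]
    rw [card_filter_middle (t' + 2) tS c fun r => ∃ y, result S e r = some y ∧
          y.take k = List.replicate k true ∧ y.length = N]
    push_cast
    rw [pow_add _ (t' + 2 + tS), pow_add _ (t' + 2)]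
    field_simp

theorem take_ofFn_eq_replicate {N k : ℕ} (hk : k ≤ N) (z : Fin N → Bool) :
    (List.ofFn z).take k = List.replicate k true ↔ ∀ j : Fin k, z (Fin.castLE hk j) = true := by
  rw [List.ext_get_iff]
  simp only [List.length_take, List.length_ofFn, List.length_replicate]
  constructor
  · rintro ⟨-, h⟩ j
    have := h j (by omega) j.2
    simp only [List.get_eq_getElem, List.getElem_take, List.getElem_ofFn,
      List.getElem_replicate] at this
    exact this
  · intro h
    refine ⟨by omega, fun i h1 h2 => ?_⟩
    simpa using h ⟨i, h2⟩

/-- Interleaving puts the first qubits of the copies at positions `0, …, k - 1`, so the event is a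
condition on a prefix. The length test discards sampler outputs that are not outcomes; the remaining
coin sequences split according to the outcome produced. -/
theorem acceptProb_eq_sum {n k m : ℕ} (S : Prog) (e : List Bool) (tS : ℕ) :
    ((Finset.univ.filter fun r : Fin tS → Bool => ∃ y, result S e r = some y ∧
        y.take k = List.replicate k true ∧ y.length = (n + 1) * k + m).card : ℝ) / 2 ^ tS =
      ∑ z ∈ acceptSet n k m, outputProb S e tS (List.ofFn z) := by
  classical
  have hk : k ≤ (n + 1) * k + m := by nlinarith [Nat.zero_le (n * k)]
  have hacc : ∀ z : Fin ((n + 1) * k + m) → Bool, z ∈ acceptSet n k m ↔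
      (List.ofFn z).take k = List.replicate k true := by
    intro z
    rw [take_ofFn_eq_replicate hk, acceptSet, Finset.mem_filter]
    simp only [Finset.mem_univ, true_and]
    refine forall_congr' fun j => ?_
    rw [show Fin.castAdd m (finProdFinEquiv ((0 : Fin (n + 1)), j)) = Fin.castLE hk j by
      ext; simp]
  have h : (Finset.univ.filter fun r : Fin tS → Bool => ∃ y, result S e r = some y ∧
        y.take k = List.replicate k true ∧ y.length = (n + 1) * k + m) =
      (acceptSet n k m).biUnion fun z =>
        Finset.univ.filter fun r : Fin tS → Bool => result S e r = some (List.ofFn z) := by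
    ext r
    simp only [Finset.mem_filter, Finset.mem_univ, true_and, Finset.mem_biUnion, hacc]
    constructor
    · rintro ⟨y, h1, h2, h3⟩
      have hy : List.ofFn (fun i : Fin ((n + 1) * k + m) => y.get (i.cast h3.symm)) = y := by
        apply List.ext_get <;> simp [h3]
      exact ⟨fun i => y.get (i.cast h3.symm), by rw [hy, h2], by rw [hy, h1]⟩
    · rintro ⟨z, h1, h2⟩
      exact ⟨_, h2, h1, by simp⟩
  rw [h, Finset.card_biUnion]
  · simp only [outputProb, Nat.cast_sum, Finset.sum_div]
  · intro z _ z' _ hz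
    refine Finset.disjoint_left.2 fun r h1 h2 => hz ?_
    simp only [Finset.mem_filter, Finset.mem_univ, true_and] at h1 h2
    exact List.ofFn_injective (Option.some.inj (h1.symm.trans h2))

theorem eval_mono (P : Polynomial ℕ) {a b : ℕ} (h : a ≤ b) : P.eval a ≤ P.eval b := by
  rw [Polynomial.eval_eq_sum_range, Polynomial.eval_eq_sum_range]
  gcongr

/-- The description of the parallel circuit is prepared from `x` by a deterministic machine. -/
theorem exec_prepare {p : Prog} (hp : p.CoinFree) {x : List Bool} {t n : ℕ} {V : Circuit n}
    (h : ∀ r : Fin t → Bool, result p x r = some (encodeCircuit V)) (k : ℕ) :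
    (encodeCircuit V).length ≤ x.length + t ∧
    ∃ s, Exec (.seq (p.rename fun i => 3 * i) (transform k))
        (init (.seq (p.rename fun i => 3 * i) (transform k)) x).2
        (t + 6 * ((200 * (k + 1) ^ 2) * (encodeCircuit V).length + 10) + 1) s ∧
      s 1 = (V.parallel k).duplicate.encode ∧ (∀ i, s (3 * (i + 1) + 1) = []) ∧
      (s 17).length = n * k + (V.parallel k).length := by
  have hf : Function.Injective fun i : ℕ => 3 * i := fun i j h => by simpa using h
  set s₀ : Store := Function.update (fun _ => []) 0 x with hs₀
  have hs₀f : s₀ ∘ (fun i : ℕ => 3 * i) = s₀ :=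
    Function.update_comp_eq_of_injective (fun _ => []) hf 0 x
  set r := List.ofFn fun _ : Fin t => false with hr
  have h' := h fun _ => false
  rw [result, ← hr, init, ← hs₀] at h'
  rcases hQ : r.foldl step ([p], s₀) with ⟨l, q⟩
  rw [hQ] at h'
  rcases l with _ | ⟨_, _⟩
  swap
  · simp [output] at h'
  have hq : q 0 = encodeCircuit V := by simpa [output] using h'
  obtain ⟨s', h1, h2, h3⟩ := Exec.rename hp hf s₀ r (by rw [hs₀f, hQ])
  rw [hs₀f, hQ] at h2
  have hs'0 : s' 0 = encodeCircuit V := by rw [← hq]; exact congrFun h2 0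
  -- The generator has only touched stacks `3 i`, so the work stacks and the sampler's stacks are
  -- still empty.
  have hs'i : ∀ i, i % 3 ≠ 0 → s' i = [] := fun i hi => by
    rw [h3 i (fun j => by omega), hs₀, Function.update_of_ne (by omega)]
  have hregs : regs s' (encodeCircuit V) [] [] [] [] [] [] = s' := by
    ext1 i
    simp only [regs]
    split_ifs with i0 i2 i5 i8 i11 i14 i17
    · rw [i0, hs'0]
    all_goals first | rfl | exact (hs'i i (by omega)).symm
  have ht := exec_transform k V s'
  rw [hregs] at ht
  refine ⟨?_, _, (h1.seq ht).mono (by simp [hr]), ?_, fun i => ?_, ?_⟩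
  · have := length_foldl_step_le r ([p], s₀) 0
    rw [hQ] at this
    simpa [hq, hs₀, hr] using this
  · simp [hs'i 1]
  · rw [Function.update_of_ne (by omega), ← hs'i (3 * (i + 1) + 1) (by omega)]
    simp only [regs]
    split_ifs <;> first | omega | rfl
  · simp

theorem size_le_length_encodeCircuit {n : ℕ} (V : Circuit n) :
    n + V.length ≤ (encodeCircuit V).length := by
  have h : V.length ≤ (V.flatMap Gate.encode).length := by
    rw [List.length_flatMap]
    refine (List.length_le_sum_of_one_le _ fun i hi => ?_).trans_eq' (by simp)
    obtain ⟨g, -, rfl⟩ := List.mem_map.1 hi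
    cases g <;> simp [Gate.encode]
  simp only [encodeCircuit, List.length_append, length_unary]
  omega

end QSampling

/-! ### The choice of constants and the two threshold bounds. -/

open QSampling in
theorem theorem1 (F ε : ℝ) (hF0 : 0 < F) (hF1 : F < 1) (hε : ε < 1)
    (hsample : QSampling.DepolarizedSampling F ε) :
    QSampling.BQP ⊆ QSampling.SBP := by
  rintro L ⟨w, V, ⟨p, T₁, hp, hrun⟩, hV⟩
  obtain ⟨S, TS, hS⟩ := hsample
  have hpos : 0 < (1 - ε) * F := mul_pos (by linarith) hF0
  obtain ⟨a, ha⟩ := pow_unbounded_of_one_lt (4 / ((1 - ε) * F)) (show (1 : ℝ) < 4 / 3 by norm_num)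
  -- With two extra copies, `4 / 2 ^ k` and `2 / 2 ^ k` are exactly the SBP thresholds `1 / 2 ^ a`
  -- and `1 / 2 ^ (a + 1)`.
  set k := a + 2 with hk
  have hgap : 4 / 2 ^ k ≤ (1 - ε) * F * (2 / 3) ^ k := by
    have h1 : (4 / 3 : ℝ) ^ a ≤ (4 / 3) ^ k := pow_le_pow_right₀ (by norm_num) (by omega)
    rw [div_lt_iff₀ hpos] at ha
    have h2 : (2 / 3 : ℝ) ^ k = (4 / 3) ^ k / 2 ^ k := by rw [← div_pow]; norm_num
    rw [h2, ← mul_div_assoc]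
    gcongr
    nlinarith
  have h4 : (4 : ℝ) / 2 ^ k = 1 / 2 ^ a := by rw [hk, pow_add]; field_simp; norm_num
  have h2 : (2 : ℝ) / 2 ^ k = 1 / 2 ^ (a + 1) := by rw [hk, pow_add, pow_add]; field_simp
  -- A bound for the length of the description of `V x`, hence for its qubits plus gates: the
  -- generator writes at most one bit per step.
  set ℓ : Polynomial ℕ := Polynomial.X + T₁ with hℓ
  refine ⟨Polynomial.C a, T₁ + Polynomial.C 6 * (Polynomial.C (200 * (k + 1) ^ 2) * ℓ) +
    TS.comp (Polynomial.C k * ℓ) + Polynomial.C (5 * k) * ℓ + Polynomial.C 100,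
    .seq (.seq (p.rename fun i => 3 * i) (transform k))
      (.seq (S.rename fun i => 3 * i + 1) (sampleCheck k)), fun x => ?_⟩
  obtain ⟨hlen, s, hs, hs1, hs2, hs3⟩ := exec_prepare hp (hrun x) k
  set m := ((V x).parallel k).length with hm
  obtain ⟨hS1, hS2⟩ := hS _ _ ((V x).parallel k).duplicate
  have hsize : (w x + 1) * k + m ≤ k * (x.length + T₁.eval x.length) := by
    rw [hm, Circuit.length_parallel, ← Nat.add_mul, Nat.mul_comm]
    exact Nat.mul_le_mul_left k ((size_le_length_encodeCircuit _).trans hlen)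
  obtain ⟨hhalt, hprob⟩ := machineAcceptProb_sample (k := k) (T := Polynomial.eval x.length
    (T₁ + Polynomial.C 6 * (Polynomial.C (200 * (k + 1) ^ 2) * ℓ) +
    TS.comp (Polynomial.C k * ℓ) + Polynomial.C (5 * k) * ℓ + Polynomial.C 100))
    hs hs1 hs2 hs3 (by nlinarith [Nat.zero_le (w x * k)]) hS1 (by
      simp only [hℓ, Polynomial.eval_add, Polynomial.eval_mul, Polynomial.eval_comp,
        Polynomial.eval_C, Polynomial.eval_X]
      have e1 := eval_mono TS hsize
      rw [hm] at e1
      have e2 := Nat.mul_le_mul_left (200 * (k + 1) ^ 2) hlen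
      rw [Nat.mul_assoc 5 k]
      omega)
  rw [acceptProb_eq_sum] at hprob
  have hsum := sum_depolarizedProb k F (V x)
  have hacc0 : 0 ≤ circuitAcceptProb (V x) :=
    Finset.sum_nonneg fun z _ => by rw [measureProb]; positivity
  refine ⟨hhalt, fun hx => ?_, fun hx => ?_⟩
  · rw [hprob, Polynomial.eval_C, ← h4]
    calc 4 / 2 ^ k ≤ (1 - ε) * F * (2 / 3) ^ k := hgap
      _ ≤ (1 - ε) * F * circuitAcceptProb (V x) ^ k := by
        gcongr
        exact (hV x).1 hx
      _ ≤ (1 - ε) * (F * circuitAcceptProb (V x) ^ k + (1 - F) / 2 ^ k) := by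
        have : 0 ≤ (1 - F) / 2 ^ k := div_nonneg (by linarith) (by positivity)
        nlinarith
      _ ≤ _ := by
        rw [← hsum, Finset.mul_sum]
        refine Finset.sum_le_sum fun z _ => ?_
        have := (abs_le.1 (hS2 z)).2
        linarith
  · rw [hprob, Polynomial.eval_C, ← h2]
    have hle : F * circuitAcceptProb (V x) ^ k + (1 - F) / 2 ^ k ≤ 1 / 2 ^ k := by
      -- Weakening `1/3` to `1/2` loses nothing of use: the noise already contributes at the scale
      -- `2 ^ (-k)`, and the weights `F` and `1 - F` now add up to 1.
      have h1 : circuitAcceptProb (V x) ^ k ≤ (1 / 2) ^ k := by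
        gcongr
        linarith [(hV x).2 hx]
      rw [one_div_pow] at h1
      calc _ ≤ F * (1 / 2 ^ k) + (1 - F) / 2 ^ k := by gcongr
        _ = 1 / 2 ^ k := by ring
    have hnn : 0 ≤ F * circuitAcceptProb (V x) ^ k + (1 - F) / 2 ^ k :=
      add_nonneg (by positivity) (div_nonneg (by linarith) (by positivity))
    calc _ ≤ ∑ z ∈ acceptSet (w x) k m,
          (1 + ε) * ((V x).parallel k).duplicate.depolarizedProb F z := by
          refine Finset.sum_le_sum fun z _ => ?_
          have := (abs_le.1 (hS2 z)).1
          linarith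
      _ = (1 + ε) * (F * circuitAcceptProb (V x) ^ k + (1 - F) / 2 ^ k) := by
          rw [← hsum, Finset.mul_sum]
      _ ≤ 2 * (1 / 2 ^ k) := by
          nlinarith
      _ = 2 / 2 ^ k := by ring
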